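/- Let $A\subset\mathbb R^2$ be compact, with coordinates $(x,y)$ such that $x$ is the sweep coordinate; vertical lines are called slices. A boundary point of $A$ is *regular* if near it $A$ is $\{y\ge\varphi(x)\}$ or $\{y\le\varphi(x)\}$ for a continuous function $\varphi$ whose graph passes through the point, and *critical* otherwise. A critical point is a *saddle* if $x|_A$ has no local extremum there. Assume general position: no two distinct saddles on the same slice are joined by an open segment of that slice contained in the interior of $A$. A *cell* of the Morse decomposition of $A$ (an edge of its Reeb graph, i.e. an element of $E_w$) is a band $K=\{x_0\le x\le x_1,\ l(x)\le y\le u(x)\}\subset A$ with $x_0<x_1$, $l,u$ continuous, $l<u$ on $(x_0,x_1)$, the graphs of $l$ and $u$ over $(x_0,x_1)$ contained in $\partial A$, no critical point in $K$ with $x_0<x<x_1$, and a critical point on each of the two end slices $K\cap\{x=x_0\}$ and $K\cap\{x=x_1\}$. An end of $K$ is of *extremum type* if in a neighbourhood of its end slice all of $A$ lies on the side of $K$ (that is, in $x\ge x_0$, respectively $x\le x_1$), and of *saddle type* otherwise. The *manifold cell* $M(K)$ is the quotient of $K$ obtained by gluing the floor (graph of $l$) to the ceiling (graph of $u$) through an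 arbitrarily chosen end-preserving homeomorphism $(x,l(x))\sim(f(x),u(x))$, where $f:[x_0,x_1]\to[x_0,x_1]$ is an increasing homeomorphism, and by collapsing the end slice at each extremum-type end to a point. Thus each saddle-type end slice that is not a single point becomes a loop; let $\partial M(K)$ be the union of these loops. Let $K_1,K_2$ be two cells attached through the Morse decomposition: they lie on opposite sides of a common critical slice, and their end slices there share a nondegenerate arc. Let $f_1,f_2$ be any choices of floor–ceiling gluings, and let $L_i\subset M(K_i)$ be the image of the end slice of $K_i$ at this common slice. Then: 1. $M(K_1)$ and $M(K_2)$ are topological 2-manifolds with boundary, with boundaries $\partial M(K_1)$ and $\partial M(K_2)$, and $L_i$ is a connected component of $\partial M(K_i)$. 2. There is an attaching map, i.e. a homeomorphism $h:L_1\to L_2$ such that $M^{\mathrm{att}}=(M(K_1)\sqcup M(K_2))/(z\sim h(z),\ z\in L_1)$ is a topological 2-manifold with boundary; its boundary is the image of $(\partial M(K_1)\setminus L_1)\sqcup(\partial M(K_2)\setminus L_2)$. 3. The same $h$ can be chosen compatible with the stitching at the critical points: for some $r>0$, whenever $z_1\in L_1$ and $z_2\in L_2$ are the images of one and the same planar point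 $p\in K_1\cap K_2$ lying in the open ball of radius $r$ about a critical point, $h(z_1)=z_2$ (so $h$ is the identity near the critical points). -/

import Mathlib

open Set Filter Topology
open scoped Manifold

/-- The Euclidean plane. Cartesian coordinates are chosen so that the sweep direction is the first
coordinate axis: `p 0` is the sweep coordinate of `p` and the vertical lines are the slices. -/
abbrev Plane : Type := EuclideanSpace ℝ (Fin 2)

/-! ### Critical points of the sweep on a planar region -/

/-- `p` is a regular boundary point of `A` for the sweep: near `p` the region is exactly one side
of the graph of a continuous function of the sweep coordinate. -/
def IsRegularBoundaryPoint (A : Set Plane) (p : Plane) : Prop :=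
  ∃ φ : ℝ → ℝ, Continuous φ ∧ φ (p 0) = p 1 ∧
    ((∀ᶠ q in 𝓝 p, q ∈ A ↔ φ (q 0) ≤ q 1) ∨ (∀ᶠ q in 𝓝 p, q ∈ A ↔ q 1 ≤ φ (q 0)))

/-- Critical points of the sweep on `A`: the boundary points that are not regular. For a smooth
boundary and nondegenerate critical points these are exactly the boundary points whose normal is
parallel to the axis of the sweep coordinate; boundaries with corners or walls are allowed. -/
def IsCriticalPoint (A : Set Plane) (p : Plane) : Prop :=
  p ∈ frontier A ∧ ¬ IsRegularBoundaryPoint A p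

/-- Saddle-type critical points: the sweep coordinate, restricted to `A`, has neither a local
minimum nor a local maximum there. -/
def IsSaddlePoint (A : Set Plane) (p : Plane) : Prop :=
  IsCriticalPoint A p ∧ ¬ IsLocalExtrOn (fun q : Plane => q 0) A p

/-- General position: two distinct saddle points are never joined by a piece of a slice that runs
through the interior of the region. -/
def SweepInGeneralPosition (A : Set Plane) : Prop :=
  ∀ c c' : Plane, IsSaddlePoint A c → IsSaddlePoint A c' → c 0 = c' 0 →
    openSegment ℝ c c' ⊆ interior A → c = c'

/-! ### Cells of the Morse decomposition -/

/-- The two ends of a cell in sweep order. -/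
inductive SweepEnd : Type
  | first
  | last

/-- A cell of the Morse (boustrophedon) decomposition of `A`, that is, an edge of the Reeb graph:
the band between a floor and a ceiling, both running along the boundary of `A`, which is cut off on
either side by the slice of a critical point and has no critical point in between. -/
structure MorseCell (A : Set Plane) where
  first : ℝ
  last : ℝ
  floor : ℝ → ℝ
  ceiling : ℝ → ℝ
  first_lt_last : first < last
  continuousOn_floor : ContinuousOn floor (Icc first last)
  continuousOn_ceiling : ContinuousOn ceiling (Icc first last)
  floor_lt_ceiling : ∀ x ∈ Ioo first last, floor x < ceiling x
  subset_region : ∀ p : Plane, p 0 ∈ Icc first last → p 1 ∈ Icc (floor (p 0)) (ceiling (p 0)) → p ∈ A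
  floor_mem_frontier : ∀ p : Plane, p 0 ∈ Ioo first last → p 1 = floor (p 0) → p ∈ frontier A
  ceiling_mem_frontier : ∀ p : Plane, p 0 ∈ Ioo first last → p 1 = ceiling (p 0) → p ∈ frontier A
  not_critical : ∀ p : Plane, p 0 ∈ Ioo first last → p 1 ∈ Icc (floor (p 0)) (ceiling (p 0)) →
    ¬ IsCriticalPoint A p
  critical_first : ∃ p : Plane, p 0 = first ∧ p 1 ∈ Icc (floor first) (ceiling first) ∧
    IsCriticalPoint A p
  critical_last : ∃ p : Plane, p 0 = last ∧ p 1 ∈ Icc (floor last) (ceiling last) ∧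
    IsCriticalPoint A p

namespace MorseCell

variable {A : Set Plane}

/-- The closed planar cell. -/
def carrier (K : MorseCell A) : Set Plane :=
  {p | p 0 ∈ Icc K.first K.last ∧ p 1 ∈ Icc (K.floor (p 0)) (K.ceiling (p 0))}

/-- The sweep coordinate of an end of the cell. -/
def endPos (K : MorseCell A) : SweepEnd → ℝ
  | SweepEnd.first => K.first
  | SweepEnd.last => K.last

/-- The slice arc bounding the cell at one of its ends. -/
def endSlice (K : MorseCell A) (s : SweepEnd) : Set Plane :=
  {p | p ∈ K.carrier ∧ p 0 = K.endPos s}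

/-- An end is of extremum type (a minimum at the first end, a maximum at the last end) if near its
slice the whole region lies on the side of the cell. All other ends are of saddle type. -/
def IsExtremumEnd (K : MorseCell A) : SweepEnd → Prop
  | SweepEnd.first => ∀ᶠ q in 𝓝ˢ (K.endSlice SweepEnd.first), q ∈ A → K.first ≤ q 0
  | SweepEnd.last => ∀ᶠ q in 𝓝ˢ (K.endSlice SweepEnd.last), q ∈ A → q 0 ≤ K.last

/-- A choice of the map that glues the floor arc of the cell to its ceiling arc: a homeomorphism
between the two arcs that preserves the ends, written in the sweep coordinate. -/
structure ArcGluing (K : MorseCell A) where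
  toFun : ℝ → ℝ
  continuousOn : ContinuousOn toFun (Icc K.first K.last)
  strictMonoOn : StrictMonoOn toFun (Icc K.first K.last)
  map_first : toFun K.first = K.first
  map_last : toFun K.last = K.last

/-- The identifications that turn a planar cell into a manifold cell: floor points are glued to
ceiling points, and the slice at an extremum-type end is collapsed to a point. In particular the
slice at a saddle-type end has its two end points identified and becomes a loop. -/
inductive Identified (K : MorseCell A) (f : K.ArcGluing) : K.carrier → K.carrier → Prop
  | arc (p q : K.carrier) (hp : p.1 1 = K.floor (p.1 0)) (hq : q.1 1 = K.ceiling (q.1 0))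
      (hpq : q.1 0 = f.toFun (p.1 0)) : Identified K f p q
  | collapse (s : SweepEnd) (hs : K.IsExtremumEnd s) (p q : K.carrier)
      (hp : p.1 ∈ K.endSlice s) (hq : q.1 ∈ K.endSlice s) : Identified K f p q

/-- The manifold cell, with the quotient topology. -/
abbrev Manifold (K : MorseCell A) (f : K.ArcGluing) : Type := Quot (K.Identified f)

/-- The quotient map from the planar cell to the manifold cell. -/
def proj (K : MorseCell A) (f : K.ArcGluing) : K.carrier → K.Manifold f := Quot.mk _

/-- The image of an end slice in the manifold cell. -/
def loop (K : MorseCell A) (f : K.ArcGluing) (s : SweepEnd) : Set (K.Manifold f) :=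
  K.proj f '' {p | p.1 ∈ K.endSlice s}

/-- The boundary of the manifold cell: the loops at the saddle-type ends. (A slice that is already
a single point in the plane does not contribute.) -/
def manifoldBoundary (K : MorseCell A) (f : K.ArcGluing) : Set (K.Manifold f) :=
  {z | ∃ s : SweepEnd, ¬ K.IsExtremumEnd s ∧ (K.endSlice s).Nontrivial ∧ z ∈ K.loop f s}

/-- Two cells are attached by the Morse decomposition along the ends `s₁` and `s₂`: they lie on
opposite sides of a common critical slice, and their end slices share more than one point (hence a
nondegenerate arc). -/
def AttachedAlong (K₁ : MorseCell A) (s₁ : SweepEnd) (K₂ : MorseCell A) (s₂ : SweepEnd) : Prop :=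
  s₁ ≠ s₂ ∧ K₁.endPos s₁ = K₂.endPos s₂ ∧ (K₁.endSlice s₁ ∩ K₂.endSlice s₂).Nontrivial

/-- Stitching with radius `r`: a point of one manifold cell and a point of the other are stitched if
they have the same planar coordinates and lie in the open ball of radius `r` centered at a critical
point. -/
def Stitched (K₁ : MorseCell A) (f₁ : K₁.ArcGluing) (K₂ : MorseCell A) (f₂ : K₂.ArcGluing) (r : ℝ)
    (z₁ : K₁.Manifold f₁) (z₂ : K₂.Manifold f₂) : Prop :=
  ∃ c : Plane, IsCriticalPoint A c ∧ ∃ (p : Plane) (h₁ : p ∈ K₁.carrier) (h₂ : p ∈ K₂.carrier),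
    p ∈ Metric.ball c r ∧ K₁.proj f₁ ⟨p, h₁⟩ = z₁ ∧ K₂.proj f₂ ⟨p, h₂⟩ = z₂

end MorseCell

/-! ### Surfaces with boundary and attaching maps -/

/-- `X` is a topological 2-manifold with boundary, whose boundary is the set `B`. -/
def IsSurfaceWithBoundary (X : Type) [TopologicalSpace X] (B : Set X) : Prop :=
  T2Space X ∧ SecondCountableTopology X ∧
    ∃ _ : ChartedSpace (EuclideanHalfSpace 2) X, (𝓡∂ 2).boundary X = B

/-- `S` is a connected component of `B`. -/
def IsComponentOf {X : Type} [TopologicalSpace X] (S B : Set X) : Prop :=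
  ∃ x ∈ B, connectedComponentIn B x = S

/-- The identification of `x` with `h x` in the disjoint union, for a map `h` between subsets. -/
inductive AttachRel {X Y : Type} {S : Set X} {T : Set Y} (h : S → T) : X ⊕ Y → X ⊕ Y → Prop
  | glue (x : S) : AttachRel h (Sum.inl x.1) (Sum.inr (h x).1)

/-- The space obtained from the disjoint union of `X` and `Y` by attaching along `h`, with the
quotient topology. -/
abbrev Attached {X Y : Type} {S : Set X} {T : Set Y} (h : S → T) : Type := Quot (AttachRel h)

/-- `h : S ≃ₜ T` is an attaching map of the surfaces `X` (with boundary `BX`) and `Y` (with boundary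
`BY`): `S` and `T` are boundary components, and attaching along `h` yields a 2-manifold, whose
boundary consists of the boundary components that were not glued. -/
structure IsAttachingMap {X Y : Type} [TopologicalSpace X] [TopologicalSpace Y]
    (BX : Set X) (BY : Set Y) {S : Set X} {T : Set Y} (h : S ≃ₜ T) : Prop where
  component_left : IsComponentOf S BX
  component_right : IsComponentOf T BY
  surface : IsSurfaceWithBoundary (Attached h)
    ((fun x : X => (Quot.mk _ (Sum.inl x) : Attached h)) '' (BX \ S) ∪
      (fun y : Y => (Quot.mk _ (Sum.inr y) : Attached h)) '' (BY \ T))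

/-! A manifold cell is a zone of the unit sphere. The gluing joins each floor point to a ceiling
point; connecting the two by an arc across the band sweeps out the whole cell, and each arc closes
up to a circle of latitude. An end that is collapsed, or whose slice is already a point, becomes a
pole; every other end becomes a boundary circle. Formally, one rectangle maps onto the cell
(`ArcGluing.square`) and onto the zone (`ArcGluing.zoneParam`), and the two maps induce the same
identifications, so compactness turns the resulting continuous bijection into a homeomorphism
(`exists_homeomorph_zone`). The zones are surfaces by explicit charts
(`isSurfaceWithBoundary_zone`), which gives the first claim.

Because the two cells lie on opposite sides of the common slice, neither end there is of extremum
type, so each loop can be placed on the equator with its cell below. Any homeomorphism of the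
equators extends to a twist of a zone along its parallels (`exists_zone_twist`). After such a twist
the gluing is the identity of the equator, and one zone together with the mirror image of the other
is again a zone. Hence every homeomorphism of the loops is an attaching map
(`isAttachingMap_of_equator`).

Only the stitching restricts the choice of `h`. A critical point in both end slices is a saddle, and
the open segment between two such points lies in the interior of `A`; general position therefore
leaves at most one (`critical_subsingleton`). Since critical points form a closed set, the points to
be stitched cluster at one height `c` (`exists_stitching_center`). In the angular coordinates of the
loops the planar identity is affine, with slope the ratio of the slice lengths, so it suffices to
have a circle homeomorphism that multiplies small angles by a given positive constant
(`exists_circle_homeomorph`), composed with rotations. -/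

/-! ### Surfaces with boundary from local charts -/

/-- `X` has at `x` a chart to the closed half plane which detects whether `x` belongs to `B`. -/
def HasHalfPlaneChartAt (X : Type) [TopologicalSpace X] (B : Set X) (x : X) : Prop :=
  ∃ e : OpenPartialHomeomorph X (EuclideanHalfSpace 2), x ∈ e.source ∧ (x ∈ B ↔ (e x).1 0 = 0)

/-- A charted space carries no compatibility condition, so an atlas amounts to one preferred chart
per point. Whether a point is in the boundary is read off in its preferred chart alone, so no
invariance of domain is needed. -/
theorem isSurfaceWithBoundary_iff {X : Type} [TopologicalSpace X] {B : Set X} :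
    IsSurfaceWithBoundary X B ↔
      T2Space X ∧ SecondCountableTopology X ∧ ∀ x, HasHalfPlaneChartAt X B x := by
  have key : ∀ y : EuclideanHalfSpace 2, (y.1 ∈ frontier (range (𝓡∂ 2)) ↔ y.1 0 = 0) := by
    intro y
    rw [frontier_range_modelWithCornersEuclideanHalfSpace]
    simp [eq_comm]
  constructor
  · rintro ⟨h2, hs, c, hB⟩
    refine ⟨h2, hs, fun x => ⟨chartAt _ x, mem_chart_source _ x, ?_⟩⟩
    rw [← hB]
    exact key (chartAt _ x x)
  · rintro ⟨h2, hs, hc⟩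
    choose e hx he using hc
    refine ⟨h2, hs, ⟨range e, e, hx, fun x => mem_range_self x⟩, ?_⟩
    ext x
    rw [he x]
    exact key (e x x)

theorem HasHalfPlaneChartAt.of_openPartialHomeomorph {X Y : Type} [TopologicalSpace X]
    [TopologicalSpace Y] {BX : Set X} {BY : Set Y} {x : X} (f : OpenPartialHomeomorph X Y)
    (hx : x ∈ f.source) (hB : x ∈ BX ↔ f x ∈ BY) (h : HasHalfPlaneChartAt Y BY (f x)) :
    HasHalfPlaneChartAt X BX x := by
  obtain ⟨e, he, heB⟩ := h
  exact ⟨f.trans e, by simp [hx, he], by rw [hB, heB]; simp⟩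

theorem IsSurfaceWithBoundary.of_homeomorph {X Y : Type} [TopologicalSpace X]
    [TopologicalSpace Y] {BX : Set X} {BY : Set Y} (h : IsSurfaceWithBoundary Y BY) (f : X ≃ₜ Y)
    (hB : ∀ x, x ∈ BX ↔ f x ∈ BY) : IsSurfaceWithBoundary X BX := by
  rw [isSurfaceWithBoundary_iff] at h ⊢
  obtain ⟨h2, hs, hc⟩ := h
  exact ⟨f.isEmbedding.t2Space, f.isEmbedding.secondCountableTopology, fun x =>
    .of_openPartialHomeomorph f.toOpenPartialHomeomorph (by simp) (hB x) (hc _)⟩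

/-- A partial homeomorphism out of a subset `S`, given by maps of the ambient space. -/
noncomputable def OpenPartialHomeomorph.ofSubset {E H : Type} [TopologicalSpace E]
    [TopologicalSpace H] {S : Set E} (x₀ : S) (f : E → H) (g : H → E) (U : Set E) (V : Set H)
    (hU : IsOpen U) (hV : IsOpen V) (hf : ContinuousOn f (S ∩ U)) (hg : ContinuousOn g V)
    (hfV : ∀ x ∈ S ∩ U, f x ∈ V) (hgU : ∀ y ∈ V, g y ∈ S ∩ U) (hgf : ∀ x ∈ S ∩ U, g (f x) = x)
    (hfg : ∀ y ∈ V, f (g y) = y) : OpenPartialHomeomorph S H := by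
  classical
  exact
  { toFun := fun x => f x
    invFun := fun y => if h : g y ∈ S then ⟨g y, h⟩ else x₀
    source := {x | x.1 ∈ U}
    target := V
    map_source' := fun x hx => hfV x ⟨x.2, hx⟩
    map_target' := fun y hy => by
      have := hgU y hy
      simpa [this.1] using this.2
    left_inv' := fun x hx => by
      have := hgf x ⟨x.2, hx⟩
      simp [this]
    right_inv' := fun y hy => by
      have := hgU y hy
      simpa [this.1] using hfg y hy
    continuousOn_toFun := hf.comp continuous_subtype_val.continuousOn fun x hx => ⟨x.2, hx⟩
    continuousOn_invFun := by
      rw [Topology.IsInducing.subtypeVal.continuousOn_iff]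
      refine hg.congr fun y hy => ?_
      have := hgU y hy
      simp [this.1]
    open_source := hU.preimage continuous_subtype_val
    open_target := hV }

/-- The plane as the open half plane. -/
noncomputable def complexToHalfPlane : OpenPartialHomeomorph ℂ (EuclideanHalfSpace 2) where
  toFun z := ⟨!₂[Real.exp z.re, z.im], by simpa using (Real.exp_pos _).le⟩
  invFun v := ⟨Real.log (v.1 0), v.1 1⟩
  source := univ
  target := {v | 0 < v.1 0}
  map_source' z _ := by simpa using Real.exp_pos _
  map_target' v _ := mem_univ _
  left_inv' z _ := by apply Complex.ext <;> simp
  right_inv' v hv := by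
    refine Subtype.ext ?_
    ext i
    fin_cases i
    · simpa using Real.exp_log hv
    · simp
  continuousOn_toFun := by
    refine Continuous.continuousOn (Continuous.subtype_mk ?_ _)
    fun_prop
  continuousOn_invFun := by
    have h0 : Continuous fun v : EuclideanHalfSpace 2 => v.1 0 :=
      (PiLp.continuous_apply 2 _ 0).comp continuous_subtype_val
    have h1 : Continuous fun v : EuclideanHalfSpace 2 => v.1 1 :=
      (PiLp.continuous_apply 2 _ 1).comp continuous_subtype_val
    have hl : ContinuousOn (fun v : EuclideanHalfSpace 2 => Real.log (v.1 0)) {v | 0 < v.1 0} :=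
      h0.continuousOn.log fun v hv => (ne_of_gt hv)
    exact Complex.equivRealProdCLM.symm.continuous.comp_continuousOn
      (hl.prodMk h1.continuousOn)
  open_source := isOpen_univ
  open_target := isOpen_lt continuous_const
    ((PiLp.continuous_apply 2 _ 0).comp continuous_subtype_val)

theorem HasHalfPlaneChartAt.of_complex {X : Type} [TopologicalSpace X] {B : Set X} {x : X}
    (e : OpenPartialHomeomorph X ℂ) (hx : x ∈ e.source) (hB : x ∉ B) :
    HasHalfPlaneChartAt X B x := by
  refine ⟨e.trans complexToHalfPlane, by simpa [complexToHalfPlane] using hx, ?_⟩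
  simp only [hB, false_iff]
  exact (Real.exp_pos (e x).re).ne'

/-! ### Spherical zones -/

/-- The zone of the unit sphere between the heights `a` and `b`. -/
def zone (a b : ℝ) : Set (ℂ × ℝ) := {p | ‖p.1‖ ^ 2 + p.2 ^ 2 = 1 ∧ p.2 ∈ Icc a b}

/-- The boundary circles of a zone; a height `-1` or `1` is a pole and contributes nothing. -/
def zoneBoundary (a b : ℝ) : Set (zone a b) :=
  {p | (p.1.2 = a ∧ a ≠ -1) ∨ (p.1.2 = b ∧ b ≠ 1)}

/-- The point of the unit sphere at height `t` in the direction `θ`. -/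
noncomputable def zonePoint (t : ℝ) (θ : Circle) : ℂ × ℝ := ((√(1 - t ^ 2) : ℝ) * (θ : ℂ), t)

theorem continuous_zonePoint : Continuous fun p : ℝ × Circle => zonePoint p.1 p.2 := by
  unfold zonePoint
  fun_prop

theorem zonePoint_mem {a b t : ℝ} (ha : -1 ≤ a) (hb : b ≤ 1) (ht : t ∈ Icc a b) (θ : Circle) :
    zonePoint t θ ∈ zone a b := by
  refine ⟨?_, ht⟩
  have h : 0 ≤ 1 - t ^ 2 := by nlinarith [ht.1, ht.2]
  simp only [zonePoint, norm_mul, Complex.norm_real, Circle.norm_coe, mul_one, Real.norm_eq_abs,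
    sq_abs, Real.sq_sqrt h]
  ring

theorem zonePoint_eq_iff {t t' : ℝ} {θ θ' : Circle} (h₁ : -1 ≤ t) (h₂ : t ≤ 1) :
    zonePoint t θ = zonePoint t' θ' ↔ t = t' ∧ (θ = θ' ∨ |t| = 1) := by
  simp only [zonePoint, Prod.mk.injEq, abs_eq zero_le_one]
  constructor
  · rintro ⟨h, rfl⟩
    refine ⟨rfl, ?_⟩
    by_cases ht : t = 1 ∨ t = -1
    · exact Or.inr ht
    · push Not at ht
      have : 0 < 1 - t ^ 2 := by
        have h3 : -1 < t := lt_of_le_of_ne h₁ (Ne.symm ht.2)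
        have h4 : t < 1 := lt_of_le_of_ne h₂ ht.1
        nlinarith
      have h5 : ((√(1 - t ^ 2) : ℝ) : ℂ) ≠ 0 := by
        exact_mod_cast (Real.sqrt_pos.2 this).ne'
      exact Or.inl (Circle.ext (mul_left_cancel₀ h5 h))
  · rintro ⟨rfl, rfl | rfl | rfl⟩ <;> simp

theorem exists_zonePoint {a b : ℝ} (p : zone a b) : ∃ θ, zonePoint p.1.2 θ = p.1 := by
  obtain ⟨⟨z, t⟩, hz, ht⟩ := p
  have h1 : √(1 - t ^ 2) = ‖z‖ := by
    rw [← Real.sqrt_sq (norm_nonneg z)]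
    congr 1
    simp only at hz
    linarith
  refine ⟨Circle.exp z.arg, ?_⟩
  simp only [zonePoint, h1, Circle.coe_exp, Complex.norm_mul_exp_arg_mul_I]

theorem isCompact_zone (a b : ℝ) : IsCompact (zone a b) := by
  refine Metric.isCompact_of_isClosed_isBounded ?_ ?_
  · refine IsClosed.inter (isClosed_eq (by fun_prop) continuous_const) ?_
    exact isClosed_Icc.preimage continuous_snd
  · refine (Metric.isBounded_iff_subset_closedBall (0 : ℂ × ℝ)).2 ⟨1, fun p hp => ?_⟩
    rw [mem_closedBall_zero_iff, Prod.norm_def, max_le_iff, Real.norm_eq_abs]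
    exact ⟨by nlinarith [hp.1, sq_nonneg p.2, norm_nonneg p.1],
      abs_le.2 ⟨by nlinarith [hp.1, sq_nonneg ‖p.1‖], by nlinarith [hp.1, sq_nonneg ‖p.1‖]⟩⟩

instance (a b : ℝ) : CompactSpace (zone a b) := isCompact_iff_compactSpace.1 (isCompact_zone a b)

/-- Reflecting a zone in the equator. -/
def zoneReflection (a b : ℝ) : zone a b ≃ₜ zone (-b) (-a) where
  toFun p := ⟨(p.1.1, -p.1.2), by simpa using p.2.1, neg_le_neg p.2.2.2, neg_le_neg p.2.2.1⟩
  invFun p := ⟨(p.1.1, -p.1.2), by simpa using p.2.1, by linarith [p.2.2.2], by linarith [p.2.2.1]⟩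
  left_inv p := by simp
  right_inv p := by simp
  continuous_toFun := by fun_prop
  continuous_invFun := by fun_prop

theorem zoneReflection_mem_zoneBoundary {a b : ℝ} (p : zone a b) :
    zoneReflection a b p ∈ zoneBoundary (-b) (-a) ↔ p ∈ zoneBoundary a b := by
  simp only [zoneBoundary, zoneReflection, mem_ofPred_eq, Homeomorph.homeomorph_mk_coe,
    Equiv.coe_fn_mk, neg_inj, ne_eq, neg_eq_iff_eq_neg (b := (1 : ℝ))]
  tauto

/-- Cylindrical coordinates: height above the lower circle, and longitude measured from the given
point, so that the branch cut lies opposite to it. -/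
theorem hasHalfPlaneChartAt_zone_of_ne_zero {a b : ℝ} (hb : b ≤ 1) (p : zone a b)
    (hp : p.1.1 ≠ 0) (hpb : p.1.2 < b) : HasHalfPlaneChartAt (zone a b) (zoneBoundary a b) p := by
  set z₀ := p.1.1 with hz₀
  have hn : (0 : ℝ) < ‖z₀‖ := norm_pos_iff.2 hp
  have hnC : ((‖z₀‖ : ℝ) : ℂ) ≠ 0 := by exact_mod_cast hn.ne'
  have hv0 : Continuous fun v : EuclideanHalfSpace 2 => v.1 0 :=
    (PiLp.continuous_apply 2 _ 0).comp continuous_subtype_val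
  have hv1 : Continuous fun v : EuclideanHalfSpace 2 => v.1 1 :=
    (PiLp.continuous_apply 2 _ 1).comp continuous_subtype_val
  have hsqrt : ∀ q ∈ zone a b, √(1 - q.2 ^ 2) = ‖q.1‖ := fun q hq => by
    rw [← Real.sqrt_sq (norm_nonneg q.1)]
    congr 1
    linarith [hq.1]
  have harg : ∀ r : ℝ, 0 < r → ∀ α ∈ Ioo (-Real.pi) Real.pi,
      ((r : ℂ) * Complex.exp (α * Complex.I) * (z₀ / (‖z₀‖ : ℝ))) / z₀ =
        ((r / ‖z₀‖ : ℝ) : ℂ) * Complex.exp (α * Complex.I) ∧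
      (((r / ‖z₀‖ : ℝ) : ℂ) * Complex.exp (α * Complex.I)).arg = α := by
    intro r hr α hα
    refine ⟨by push_cast; field_simp, ?_⟩
    rw [Complex.arg_real_mul _ (div_pos hr hn), Complex.arg_exp_mul_I,
      toIocMod_eq_self]
    exact ⟨hα.1, by linarith [hα.2]⟩
  -- The `max` only makes the map land in the half plane for every argument; on the zone it equals
  -- `q.2 - a`. The bounds in the target keep the height strictly between the poles, where the
  -- inverse has a positive radius.
  refine ⟨OpenPartialHomeomorph.ofSubset p
    (fun q => ⟨!₂[max (q.2 - a) 0, (q.1 / z₀).arg], le_max_right (q.2 - a) 0⟩)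
    (fun v => ((√(1 - (v.1 0 + a) ^ 2) : ℝ) * Complex.exp ((v.1 1 : ℝ) * Complex.I) *
      (z₀ / (‖z₀‖ : ℝ)), v.1 0 + a))
    {q | q.2 < b ∧ q.1 / z₀ ∈ Complex.slitPlane}
    {v | v.1 0 + a < b ∧ -1 < v.1 0 + a ∧ v.1 1 ∈ Ioo (-Real.pi) Real.pi} ?_ ?_ ?_ ?_ ?_ ?_ ?_ ?_,
    ?_, ?_⟩
  · exact (isOpen_lt continuous_snd continuous_const).inter
      (Complex.isOpen_slitPlane.preimage (by fun_prop))
  · exact (isOpen_lt (hv0.add continuous_const) continuous_const).inter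
      ((isOpen_lt continuous_const (hv0.add continuous_const)).inter (isOpen_Ioo.preimage hv1))
  · have h1 : ContinuousOn (fun q : ℂ × ℝ => (q.1 / z₀).arg)
        (zone a b ∩ {q | q.2 < b ∧ q.1 / z₀ ∈ Complex.slitPlane}) := fun q hq =>
      ContinuousAt.continuousWithinAt
        (ContinuousAt.comp (Complex.continuousAt_arg hq.2.2)
          (f := fun q : ℂ × ℝ => q.1 / z₀) (by fun_prop))
    have h0 : Continuous fun q : ℂ × ℝ => max (q.2 - a) 0 := by fun_prop
    have hi : IsInducing (Subtype.val : EuclideanHalfSpace 2 → EuclideanSpace ℝ (Fin 2)) := ⟨rfl⟩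
    refine hi.continuousOn_iff.2 ?_
    refine (PiLp.continuous_toLp 2 _).comp_continuousOn (continuousOn_pi.2 fun i => ?_)
    fin_cases i
    · exact h0.continuousOn
    · exact h1
  · refine Continuous.continuousOn ?_
    fun_prop
  · rintro q ⟨hq, hqb, hs⟩
    have h1 : max (q.2 - a) 0 + a = q.2 := by
      rw [max_eq_left (by linarith [hq.2.1])]
      ring
    have hq0 : q.1 ≠ 0 := fun h => by
      rw [h, zero_div] at hs
      exact Complex.slitPlane_ne_zero hs rfl
    have h2 : 0 < ‖q.1‖ := norm_pos_iff.2 hq0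
    have h3 := hq.1
    refine ⟨by simpa [h1] using hqb, ?_, ?_⟩
    · simp only [Matrix.cons_val_zero, h1]
      nlinarith
    · simp only [Matrix.cons_val_one]
      refine ⟨Complex.neg_pi_lt_arg _, lt_of_le_of_ne (Complex.arg_le_pi _) ?_⟩
      exact (Complex.mem_slitPlane_iff_arg.1 hs).1
  · rintro v ⟨hvb, hva, hvpi⟩
    have h1 : 0 < 1 - (v.1 0 + a) ^ 2 := by nlinarith
    have h2 := Real.sqrt_pos.2 h1
    obtain ⟨h3, h4⟩ := harg _ h2 _ hvpi
    refine ⟨⟨?_, by linarith [v.2], hvb.le⟩, hvb, ?_⟩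
    · rw [norm_mul, norm_mul, norm_div, Complex.norm_real, Complex.norm_real, norm_norm,
        div_self hn.ne', mul_one, Complex.norm_exp_ofReal_mul_I, mul_one, Real.norm_eq_abs, sq_abs,
        Real.sq_sqrt h1.le]
      ring
    · simp only [h3]
      rw [Complex.mem_slitPlane_iff_arg, h4]
      refine ⟨hvpi.2.ne, mul_ne_zero ?_ (Complex.exp_ne_zero _)⟩
      exact_mod_cast (div_pos h2 hn).ne'
  · rintro q ⟨hq, hqb, hs⟩
    have h1 : max (q.2 - a) 0 + a = q.2 := by
      rw [max_eq_left (by linarith [hq.2.1])]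
      ring
    simp only [Matrix.cons_val_zero, Matrix.cons_val_one, h1, hsqrt q hq]
    refine Prod.ext ?_ rfl
    have h2 := Complex.norm_mul_exp_arg_mul_I (q.1 / z₀)
    rw [norm_div] at h2
    push_cast at h2
    simp only
    field_simp at h2 ⊢
    rw [← h2]
  · rintro v ⟨hvb, hva, hvpi⟩
    have h1 : 0 < 1 - (v.1 0 + a) ^ 2 := by nlinarith
    obtain ⟨h3, h4⟩ := harg _ (Real.sqrt_pos.2 h1) _ hvpi
    refine Subtype.ext ?_
    ext i
    fin_cases i
    · simpa using v.2
    · simp only [h3, h4]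
      simp
  · exact ⟨hpb, by rw [← hz₀, div_self hp]; exact Complex.one_mem_slitPlane⟩
  · have h1 := p.2.1
    have h2 := p.2.2.1
    change _ ↔ max (p.1.2 - a) 0 = 0
    rw [max_eq_left (by linarith), sub_eq_zero]
    constructor
    · rintro (⟨h, -⟩ | ⟨h, -⟩)
      · exact h
      · exact absurd h hpb.ne
    · intro h
      refine Or.inl ⟨h, fun h' => ?_⟩
      have h3 : 0 < ‖p.1.1‖ := hn
      have h4 : p.1.2 = -1 := h.trans h'
      rw [h4] at h1
      nlinarith

/-- Orthogonal projection of the open lower hemisphere to the unit disc; `0 ≤ b` ensures that the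
zone contains that hemisphere. -/
theorem hasHalfPlaneChartAt_zone_southPole {b : ℝ} (hb : 0 ≤ b) (p : zone (-1) b)
    (hp : p.1.2 = -1) : HasHalfPlaneChartAt (zone (-1) b) (zoneBoundary (-1) b) p := by
  refine .of_complex (OpenPartialHomeomorph.ofSubset p (fun q => q.1)
    (fun z => (z, -√(1 - ‖z‖ ^ 2))) {q | q.2 < 0} (Metric.ball 0 1)
    (isOpen_lt continuous_snd continuous_const) Metric.isOpen_ball continuous_fst.continuousOn
    (Continuous.continuousOn (by fun_prop)) ?_ ?_ ?_ ?_) ?_ ?_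
  · rintro q ⟨hq, hq0⟩
    have h1 : q.2 < 0 := hq0
    have := hq.1
    rw [mem_ball_zero_iff]
    nlinarith [norm_nonneg q.1]
  · intro z hz
    rw [mem_ball_zero_iff] at hz
    have h1 : 0 < 1 - ‖z‖ ^ 2 := by nlinarith [norm_nonneg z]
    have h2 := Real.sqrt_pos.2 h1
    refine ⟨⟨by simp [Real.sq_sqrt h1.le], ?_, by simp only; linarith⟩, by simpa using h2⟩
    have : √(1 - ‖z‖ ^ 2) ≤ 1 := Real.sqrt_le_one.2 (by nlinarith [norm_nonneg z])
    simpa only [neg_le_neg_iff] using this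
  · rintro q ⟨hq, hq0⟩
    have h1 : q.2 < 0 := hq0
    have h2 : 1 - ‖q.1‖ ^ 2 = (-q.2) ^ 2 := by linarith [hq.1, neg_sq q.2]
    refine Prod.ext rfl ?_
    simp only [h2, Real.sqrt_sq (neg_pos.2 h1).le, neg_neg]
  · intro z _
    rfl
  · change p.1.2 < 0
    rw [hp]
    norm_num
  · rintro (⟨-, h⟩ | ⟨h, -⟩)
    · exact h rfl
    · rw [hp] at h
      linarith

theorem hasHalfPlaneChartAt_zone_of_lt {a b : ℝ} (ha : -1 ≤ a) (hb₀ : 0 ≤ b) (hb : b ≤ 1)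
    (p : zone a b) (hpb : p.1.2 < b) : HasHalfPlaneChartAt (zone a b) (zoneBoundary a b) p := by
  by_cases hp : p.1.1 = 0
  · have h1 := p.2.1
    rw [hp] at h1
    have h2 : p.1.2 = -1 := by
      have h3 : (p.1.2 + 1) * (p.1.2 - 1) = 0 := by
        simp only [norm_zero] at h1
        linarith
      rcases mul_eq_zero.1 h3 with h | h
      · linarith
      · linarith
    obtain rfl : a = -1 := le_antisymm (h2 ▸ p.2.2.1) ha
    exact hasHalfPlaneChartAt_zone_southPole hb₀ p h2
  · exact hasHalfPlaneChartAt_zone_of_ne_zero hb p hp hpb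

/-- The charts above miss only the top circle or north pole, which the reflection in the equator
carries to the bottom. -/
theorem isSurfaceWithBoundary_zone {a b : ℝ} (ha : -1 ≤ a) (ha₀ : a ≤ 0) (hab : a < b)
    (hb₀ : 0 ≤ b) (hb : b ≤ 1) : IsSurfaceWithBoundary (zone a b) (zoneBoundary a b) := by
  refine isSurfaceWithBoundary_iff.2 ⟨inferInstance, inferInstance, fun p => ?_⟩
  rcases p.2.2.2.lt_or_eq with h | h
  · exact hasHalfPlaneChartAt_zone_of_lt ha hb₀ hb p h
  · refine .of_openPartialHomeomorph (zoneReflection a b).toOpenPartialHomeomorph (by simp)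
      (zoneReflection_mem_zoneBoundary p).symm ?_
    refine hasHalfPlaneChartAt_zone_of_lt (by linarith) (by linarith) (by linarith) _ ?_
    change -p.1.2 < -a
    linarith

/-! ### Manifold cells as spherical zones -/

theorem plane_ext {p q : Plane} (h₀ : p 0 = q 0) (h₁ : p 1 = q 1) : p = q := by
  ext i
  fin_cases i
  · exact h₀
  · exact h₁

theorem circle_exp_two_pi_mul_eq_iff {s s' : ℝ} (hs : s ∈ Icc (0 : ℝ) 1)
    (hs' : s' ∈ Icc (0 : ℝ) 1) :
    Circle.exp (2 * Real.pi * s) = Circle.exp (2 * Real.pi * s') ↔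
      s = s' ∨ (s = 0 ∧ s' = 1) ∨ (s = 1 ∧ s' = 0) := by
  rw [Circle.exp_eq_exp]
  constructor
  · rintro ⟨m, hm⟩
    have h : s = s' + m := by
      have : 2 * Real.pi * (s - (s' + m)) = 0 := by linarith
      rcases mul_eq_zero.1 this with h | h
      · exact absurd h Real.two_pi_pos.ne'
      · linarith
    have h1 : (-2 : ℝ) < m := by linarith [hs.1, hs'.2]
    have h2 : (m : ℝ) < 2 := by linarith [hs.2, hs'.1]
    have h1' : -2 < m := by exact_mod_cast h1
    have h2' : m < 2 := by exact_mod_cast h2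
    obtain rfl | rfl | rfl : m = -1 ∨ m = 0 ∨ m = 1 := by omega
    · push_cast at h
      exact Or.inr (Or.inl ⟨by linarith [hs.1, hs'.2], by linarith [hs.1, hs'.2]⟩)
    · left
      simpa using h
    · push_cast at h
      exact Or.inr (Or.inr ⟨by linarith [hs.2, hs'.1], by linarith [hs.2, hs'.1]⟩)
  · rintro (rfl | ⟨rfl, rfl⟩ | ⟨rfl, rfl⟩)
    · exact ⟨0, by simp⟩
    · exact ⟨-1, by push_cast; ring⟩
    · exact ⟨1, by push_cast; ring⟩

theorem exists_circle_exp_two_pi_mul (θ : Circle) :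
    ∃ s ∈ Icc (0 : ℝ) 1, Circle.exp (2 * Real.pi * s) = θ := by
  have hpi := Real.two_pi_pos
  have h1 := Complex.neg_pi_lt_arg (θ : ℂ)
  have h2 := Complex.arg_le_pi (θ : ℂ)
  rcases le_total 0 (Complex.arg θ) with h | h
  · refine ⟨Complex.arg θ / (2 * Real.pi), ⟨by positivity, ?_⟩, ?_⟩
    · rw [div_le_one hpi]
      linarith [Real.pi_pos]
    · rw [mul_div_cancel₀ _ hpi.ne', Circle.exp_arg]
  · refine ⟨(Complex.arg θ + 2 * Real.pi) / (2 * Real.pi), ⟨?_, ?_⟩, ?_⟩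
    · exact div_nonneg (by linarith [Real.pi_pos]) hpi.le
    · rw [div_le_one hpi]
      linarith
    · rw [mul_div_cancel₀ _ hpi.ne', Circle.exp_add_two_pi, Circle.exp_arg]

/-- The height of the circle of `zone a b` that corresponds to an end of a cell. -/
def endHeight (a b : ℝ) : SweepEnd → ℝ
  | SweepEnd.first => a
  | SweepEnd.last => b

namespace MorseCell

variable {A : Set Plane} (K : MorseCell A)

theorem floor_le_ceiling {x : ℝ} (hx : x ∈ Icc K.first K.last) : K.floor x ≤ K.ceiling x := by
  have hcl : x ∈ closure (Ioo K.first K.last) := by rwa [closure_Ioo K.first_lt_last.ne]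
  exact ContinuousWithinAt.closure_le hcl
    ((K.continuousOn_floor x hx).mono Ioo_subset_Icc_self)
    ((K.continuousOn_ceiling x hx).mono Ioo_subset_Icc_self)
    fun y hy => (K.floor_lt_ceiling y hy).le

theorem endPos_mem (s : SweepEnd) : K.endPos s ∈ Icc K.first K.last := by
  cases s
  · exact left_mem_Icc.2 K.first_lt_last.le
  · exact right_mem_Icc.2 K.first_lt_last.le

theorem exists_eq_endPos {x : ℝ} (hx : x ∈ Icc K.first K.last)
    (h : K.ceiling x ≤ K.floor x) : ∃ s, x = K.endPos s := by
  by_contra! hne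
  have h1 : K.first < x := lt_of_le_of_ne hx.1 (hne SweepEnd.first).symm
  have h2 : x < K.last := lt_of_le_of_ne hx.2 (hne SweepEnd.last)
  exact (K.floor_lt_ceiling x ⟨h1, h2⟩).not_ge h

theorem nontrivial_endSlice_iff (s : SweepEnd) :
    (K.endSlice s).Nontrivial ↔ K.floor (K.endPos s) < K.ceiling (K.endPos s) := by
  constructor
  · rintro ⟨p, ⟨⟨-, hp⟩, hps⟩, q, ⟨⟨-, hq⟩, hqs⟩, hpq⟩
    rw [hps] at hp
    rw [hqs] at hq
    by_contra h
    push Not at h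
    exact hpq (plane_ext (hps.trans hqs.symm) (le_antisymm (hp.2.trans (h.trans hq.1))
      (hq.2.trans (h.trans hp.1))))
  · intro h
    refine ⟨!₂[K.endPos s, K.floor (K.endPos s)], ⟨⟨?_, ?_⟩, ?_⟩,
      !₂[K.endPos s, K.ceiling (K.endPos s)], ⟨⟨?_, ?_⟩, ?_⟩, ?_⟩
    · simpa using K.endPos_mem s
    · simpa using h.le
    · simp
    · simpa using K.endPos_mem s
    · simpa using h.le
    · simp
    · intro he
      have : K.floor (K.endPos s) = K.ceiling (K.endPos s) := by
        simpa using congrArg (fun p : Plane => p 1) he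
      exact h.ne this

theorem isCompact_carrier : IsCompact K.carrier := by
  have h : K.carrier = (fun p : ℝ × ℝ => (!₂[p.1, (1 - p.2) * K.floor p.1 + p.2 * K.ceiling p.1] :
      Plane)) '' (Icc K.first K.last ×ˢ Icc 0 1) := by
    ext p
    constructor
    · rintro ⟨hx, hy⟩
      obtain ⟨s, t, hs, ht, hst, h⟩ :=
        (segment_eq_Icc (K.floor_le_ceiling hx)).symm ▸ hy
      refine ⟨(p 0, t), ⟨hx, ht, by linarith⟩, plane_ext (by simp) ?_⟩
      simp only [smul_eq_mul] at h
      simp only [Matrix.cons_val_one, ← h]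
      rw [show s = 1 - t by linarith]
      simp
    · rintro ⟨⟨x, t⟩, ⟨hx, ht⟩, rfl⟩
      have := K.floor_le_ceiling hx
      refine ⟨by simpa using hx, ?_⟩
      simp only [Matrix.cons_val_one, Matrix.cons_val_zero]
      constructor <;> nlinarith [ht.1, ht.2]
  rw [h]
  refine (isCompact_Icc.prod isCompact_Icc).image_of_continuousOn ?_
  have h1 : ContinuousOn (fun p : ℝ × ℝ => K.floor p.1) (Icc K.first K.last ×ˢ Icc 0 1) :=
    K.continuousOn_floor.comp continuousOn_fst fun p hp => hp.1
  have h2 : ContinuousOn (fun p : ℝ × ℝ => K.ceiling p.1) (Icc K.first K.last ×ˢ Icc 0 1) :=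
    K.continuousOn_ceiling.comp continuousOn_fst fun p hp => hp.1
  refine (PiLp.continuous_toLp 2 _).comp_continuousOn (continuousOn_pi.2 fun i => ?_)
  fin_cases i
  · exact continuousOn_fst
  · exact ((continuous_const.sub continuous_snd).continuousOn.mul h1).add
      (continuousOn_snd.mul h2)

instance : CompactSpace K.carrier := isCompact_iff_compactSpace.1 K.isCompact_carrier

/-! ### One rectangle parametrizing both the planar cell and the zone -/

namespace ArcGluing

variable {K} (f : K.ArcGluing)

theorem mem_Icc {x : ℝ} (hx : x ∈ Icc K.first K.last) : f.toFun x ∈ Icc K.first K.last := by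
  have h1 := f.strictMonoOn.monotoneOn (left_mem_Icc.2 K.first_lt_last.le) hx hx.1
  have h2 := f.strictMonoOn.monotoneOn hx (right_mem_Icc.2 K.first_lt_last.le) hx.2
  rw [f.map_first] at h1
  rw [f.map_last] at h2
  exact ⟨h1, h2⟩

theorem map_endPos (s : SweepEnd) : f.toFun (K.endPos s) = K.endPos s := by
  cases s
  · exact f.map_first
  · exact f.map_last

/-- The abscissa, in the planar cell, of the point at parameter `s` of the arc that joins the
floor point over `x` to the ceiling point glued to it. -/
def shear (x s : ℝ) : ℝ := (1 - s) * x + s * f.toFun x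

/-- A convex combination of the identity and an increasing map is increasing. Hence at each relative
height the joining arcs do not cross. -/
theorem shear_strictMonoOn {s : ℝ} (hs : s ∈ Icc (0 : ℝ) 1) :
    StrictMonoOn (fun x => f.shear x s) (Icc K.first K.last) := by
  intro x hx y hy hxy
  have h := f.strictMonoOn hx hy hxy
  simp only [shear]
  rcases hs.1.eq_or_lt with h0 | h0
  · subst h0
    simpa using hxy
  · nlinarith [hs.2, mul_pos h0 (sub_pos.2 h)]

theorem shear_endPos (e : SweepEnd) (s : ℝ) : f.shear (K.endPos e) s = K.endPos e := by
  rw [shear, map_endPos]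
  ring

theorem eq_endPos_of_shear {x s : ℝ} {e : SweepEnd} (hx : x ∈ Icc K.first K.last)
    (hs : s ∈ Icc (0 : ℝ) 1) (h : f.shear x s = K.endPos e) : x = K.endPos e :=
  (f.shear_strictMonoOn hs).injOn hx (K.endPos_mem e) (h.trans (f.shear_endPos e s).symm)

theorem shear_mem {x s : ℝ} (hx : x ∈ Icc K.first K.last) (hs : s ∈ Icc (0 : ℝ) 1) :
    f.shear x s ∈ Icc K.first K.last := by
  have h := f.mem_Icc hx
  simp only [shear]
  constructor <;> nlinarith [hs.1, hs.2, h.1, h.2, hx.1, hx.2]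

theorem continuousOn_shear {s : ℝ} :
    ContinuousOn (fun x => f.shear x s) (Icc K.first K.last) :=
  (continuousOn_const.mul continuousOn_id).add (continuousOn_const.mul f.continuousOn)

/-- The parametrization of the planar cell by a rectangle whose horizontal sides are matched by the
gluing. -/
noncomputable def square (q : Icc K.first K.last × Icc (0 : ℝ) 1) : K.carrier :=
  ⟨!₂[f.shear q.1 q.2, (1 - q.2) * K.floor (f.shear q.1 q.2) +
      q.2 * K.ceiling (f.shear q.1 q.2)], by
    have h := f.shear_mem q.1.2 q.2.2
    have h1 := K.floor_le_ceiling h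
    have h2 := q.2.2
    refine ⟨by simpa using h, ?_⟩
    simp only [Matrix.cons_val_one, Matrix.cons_val_zero]
    constructor <;> nlinarith [h2.1, h2.2]⟩

theorem square_zero (q : Icc K.first K.last × Icc (0 : ℝ) 1) :
    (f.square q).1 0 = f.shear q.1 q.2 := by simp [square]

theorem square_one (q : Icc K.first K.last × Icc (0 : ℝ) 1) :
    (f.square q).1 1 = (1 - q.2) * K.floor (f.shear q.1 q.2) +
      q.2 * K.ceiling (f.shear q.1 q.2) := by simp [square]

theorem continuous_square : Continuous f.square := by
  have h0 : Continuous fun q : Icc K.first K.last × Icc (0 : ℝ) 1 => f.shear q.1 q.2 := by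
    have := f.continuousOn.comp_continuous
      (continuous_subtype_val.comp (continuous_fst (X := Icc K.first K.last) (Y := Icc (0 : ℝ) 1)))
      fun q => q.1.2
    simp only [shear]
    exact Continuous.add (by fun_prop) (Continuous.mul (by fun_prop) this)
  have h1 := K.continuousOn_floor.comp_continuous h0 fun q => f.shear_mem q.1.2 q.2.2
  have h2 := K.continuousOn_ceiling.comp_continuous h0 fun q => f.shear_mem q.1.2 q.2.2
  refine Continuous.subtype_mk ((PiLp.continuous_toLp 2 _).comp (continuous_pi fun i => ?_)) _
  fin_cases i
  · exact h0
  · exact Continuous.add (Continuous.mul (by fun_prop) h1) (Continuous.mul (by fun_prop) h2)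

theorem exists_square_eq (p : K.carrier) : ∃ q, f.square q = p ∧
    (q.2 : ℝ) = (p.1 1 - K.floor (p.1 0)) / (K.ceiling (p.1 0) - K.floor (p.1 0)) := by
  obtain ⟨p, hx, hy⟩ := p
  have hle := K.floor_le_ceiling hx
  -- On a one-point slice the division by zero returns 0, which is still a valid parameter because
  -- the point lies on the floor.
  set s := (p 1 - K.floor (p 0)) / (K.ceiling (p 0) - K.floor (p 0)) with hs_def
  have hs : s ∈ Icc (0 : ℝ) 1 :=
    ⟨div_nonneg (by linarith [hy.1]) (by linarith),
      div_le_one_of_le₀ (by linarith [hy.2]) (by linarith)⟩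
  have hsy : (1 - s) * K.floor (p 0) + s * K.ceiling (p 0) = p 1 := by
    have : s * (K.ceiling (p 0) - K.floor (p 0)) = p 1 - K.floor (p 0) := by
      rcases hle.eq_or_lt with h | h
      · have : p 1 = K.floor (p 0) := le_antisymm (hy.2.trans h.ge) hy.1
        rw [this, ← h]
        ring
      · exact div_mul_cancel₀ _ (sub_pos.2 h).ne'
    linarith
  obtain ⟨x, hx', hxs⟩ : p 0 ∈ (fun x => f.shear x s) '' Icc K.first K.last := by
    refine intermediate_value_Icc K.first_lt_last.le f.continuousOn_shear ?_
    have h1 := f.shear_endPos SweepEnd.first s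
    have h2 := f.shear_endPos SweepEnd.last s
    simp only [endPos] at h1 h2
    rwa [h1, h2]
  refine ⟨(⟨x, hx'⟩, ⟨s, hs⟩), Subtype.ext (plane_ext ?_ ?_), rfl⟩
  · rw [square_zero]
    exact hxs
  · rw [square_one]
    simp only at hxs ⊢
    rw [hxs, hsy]

/-- The height in the zone `zone a b` of the circle over an abscissa. -/
noncomputable def height (_ : K.ArcGluing) (a b x : ℝ) : ℝ :=
  a + (x - K.first) / (K.last - K.first) * (b - a)

variable {a b : ℝ}

theorem height_strictMono (hab : a < b) : StrictMono (f.height a b) := by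
  intro x y hxy
  have := sub_pos.2 K.first_lt_last
  have := sub_pos.2 hab
  simp only [height]
  gcongr

theorem height_endPos (e : SweepEnd) : f.height a b (K.endPos e) = endHeight a b e := by
  have := sub_pos.2 K.first_lt_last
  cases e
  · simp [height, endPos, endHeight]
  · simp only [height, endPos, endHeight]
    field_simp
    ring

theorem height_mem (hab : a < b) {x : ℝ} (hx : x ∈ Icc K.first K.last) :
    f.height a b x ∈ Icc a b := by
  have h1 := (f.height_strictMono hab).monotone hx.1
  have h2 := (f.height_strictMono hab).monotone hx.2
  have h3 := f.height_endPos (a := a) (b := b) SweepEnd.first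
  have h4 := f.height_endPos (a := a) (b := b) SweepEnd.last
  simp only [endPos, endHeight] at h3 h4
  exact ⟨h3.symm.trans_le h1, h2.trans_eq h4⟩

theorem exists_height_eq {t : ℝ} (ht : t ∈ Icc a b) :
    ∃ x ∈ Icc K.first K.last, f.height a b x = t := by
  have h3 := f.height_endPos (a := a) (b := b) SweepEnd.first
  have h4 := f.height_endPos (a := a) (b := b) SweepEnd.last
  simp only [endPos, endHeight] at h3 h4
  refine intermediate_value_Icc K.first_lt_last.le (f := f.height a b) ?_ (by rwa [h3, h4])
  unfold height
  fun_prop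

theorem height_eq_endHeight_iff (hab : a < b) {x : ℝ} {e : SweepEnd} :
    f.height a b x = endHeight a b e ↔ x = K.endPos e := by
  rw [← f.height_endPos, (f.height_strictMono hab).injective.eq_iff]

/-- The parametrization of a zone by the same rectangle. -/
noncomputable def zoneParam (ha : -1 ≤ a) (hab : a < b) (hb : b ≤ 1)
    (q : Icc K.first K.last × Icc (0 : ℝ) 1) : zone a b :=
  ⟨zonePoint (f.height a b q.1) (Circle.exp (2 * Real.pi * q.2)),
    zonePoint_mem ha hb (f.height_mem hab q.1.2) _⟩

variable (ha : -1 ≤ a) (hab : a < b) (hb : b ≤ 1)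

theorem continuous_zoneParam : Continuous (f.zoneParam ha hab hb) := by
  refine Continuous.subtype_mk (continuous_zonePoint.comp (Continuous.prodMk ?_ ?_)) _
  · fun_prop
  · fun_prop

theorem surjective_zoneParam : Function.Surjective (f.zoneParam ha hab hb) := by
  intro p
  obtain ⟨θ, hθ⟩ := exists_zonePoint p
  obtain ⟨s, hs, hsθ⟩ := exists_circle_exp_two_pi_mul θ
  obtain ⟨x, hx, hxp⟩ := f.exists_height_eq p.2.2
  refine ⟨(⟨x, hx⟩, ⟨s, hs⟩), Subtype.ext ?_⟩
  simp only [zoneParam, hxp, hsθ, hθ]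

/-- The fibres on the zone side: the two horizontal sides of the rectangle are matched, and a
vertical side is crushed exactly when its height is a pole. -/
theorem zoneParam_eq_iff (q q' : Icc K.first K.last × Icc (0 : ℝ) 1) :
    f.zoneParam ha hab hb q = f.zoneParam ha hab hb q' ↔ q.1 = q'.1 ∧
      ((q.2 = q'.2 ∨ (q.2 = 0 ∧ q'.2 = 1) ∨ (q.2 = 1 ∧ q'.2 = 0)) ∨
        ∃ e, (q.1 : ℝ) = K.endPos e ∧ |endHeight a b e| = 1) := by
  have hm := f.height_mem hab q.1.2
  rw [Subtype.ext_iff]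
  simp only [zoneParam]
  rw [zonePoint_eq_iff (ha.trans hm.1) (hm.2.trans hb), (f.height_strictMono hab).injective.eq_iff,
    circle_exp_two_pi_mul_eq_iff q.2.2 q'.2.2, ← Subtype.ext_iff]
  have h : |f.height a b q.1| = 1 ↔ ∃ e, (q.1 : ℝ) = K.endPos e ∧ |endHeight a b e| = 1 := by
    constructor
    · intro h
      rcases (abs_eq zero_le_one).1 h with h1 | h1
      · have hb1 : b = 1 := le_antisymm hb (h1 ▸ hm.2)
        refine ⟨SweepEnd.last, (f.height_eq_endHeight_iff (e := SweepEnd.last) hab).1 ?_, ?_⟩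
        · rw [h1, ← hb1, endHeight]
        · rw [endHeight, hb1, abs_one]
      · have ha1 : a = -1 := le_antisymm (h1 ▸ hm.1) ha
        refine ⟨SweepEnd.first, (f.height_eq_endHeight_iff (e := SweepEnd.first) hab).1 ?_, ?_⟩
        · rw [h1, ← ha1, endHeight]
        · rw [endHeight, ha1, abs_neg, abs_one]
    · rintro ⟨e, he, h⟩
      rwa [he, f.height_endPos]
  rw [h]
  simp only [Subtype.ext_iff, Icc.coe_zero, Icc.coe_one]

/-- The ends of the cell which are collapsed are those at the poles of the zone. -/
def PolesMatch (K : MorseCell A) (a b : ℝ) : Prop :=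
  ∀ e, |endHeight a b e| = 1 ↔ K.IsExtremumEnd e ∨ ¬ (K.endSlice e).Nontrivial

variable {f}

/-- A one-point slice can occur only at an end of the cell, and `PolesMatch` puts a pole there. -/
theorem zoneParam_eq_of_degenerate (hc : PolesMatch K a b)
    {q q' : Icc K.first K.last × Icc (0 : ℝ) 1}
    (hq : f.shear q.1 q.2 = f.shear q'.1 q'.2)
    (hd : K.ceiling (f.shear q.1 q.2) ≤ K.floor (f.shear q.1 q.2)) :
    f.zoneParam ha hab hb q = f.zoneParam ha hab hb q' := by
  obtain ⟨e, he⟩ := K.exists_eq_endPos (f.shear_mem q.1.2 q.2.2) hd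
  have h1 := f.eq_endPos_of_shear q.1.2 q.2.2 he
  have h2 := f.eq_endPos_of_shear q'.1.2 q'.2.2 (hq ▸ he)
  refine (f.zoneParam_eq_iff ha hab hb q q').2 ⟨Subtype.ext (h1.trans h2.symm),
    Or.inr ⟨e, h1, (hc e).2 (Or.inr ?_)⟩⟩
  rw [nontrivial_endSlice_iff, not_lt, ← he]
  exact hd

theorem zoneParam_eq_of_square_eq (hc : PolesMatch K a b)
    {q q' : Icc K.first K.last × Icc (0 : ℝ) 1} (h : f.square q = f.square q') :
    f.zoneParam ha hab hb q = f.zoneParam ha hab hb q' := by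
  have h0 := congrArg (fun p : K.carrier => p.1 0) h
  have h1 := congrArg (fun p : K.carrier => p.1 1) h
  simp only [square_zero, square_one] at h0 h1
  rcases le_or_gt (K.ceiling (f.shear q.1 q.2)) (K.floor (f.shear q.1 q.2)) with hd | hd
  · exact zoneParam_eq_of_degenerate ha hab hb hc h0 hd
  · rw [← h0] at h1
    have hs : (q.2 : ℝ) = q'.2 := by
      have : ((q.2 : ℝ) - q'.2) * (K.ceiling (f.shear q.1 q.2) - K.floor (f.shear q.1 q.2)) = 0 := by
        linarith
      rcases mul_eq_zero.1 this with h | h <;> linarith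
    rw [← hs] at h0
    have hx := (f.shear_strictMonoOn q.2.2).injOn q.1.2 q'.1.2 h0
    rw [Prod.ext (Subtype.ext hx) (Subtype.ext hs)]

/-- On nondegenerate slices a floor point has parameter 0 and a ceiling point has parameter 1;
injectivity of the gluing then shows that both lie on the same joining arc. -/
theorem zoneParam_eq_of_arc (hc : PolesMatch K a b)
    {q q' : Icc K.first K.last × Icc (0 : ℝ) 1}
    (hq : (f.square q).1 1 = K.floor ((f.square q).1 0))
    (hq' : (f.square q').1 1 = K.ceiling ((f.square q').1 0))
    (hqq' : (f.square q').1 0 = f.toFun ((f.square q).1 0)) :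
    f.zoneParam ha hab hb q = f.zoneParam ha hab hb q' := by
  simp only [square_zero, square_one] at hq hq' hqq'
  -- The gluing fixes both ends, so over an end the two glued points lie on the same slice.
  have hdeg : (∃ e, f.shear q.1 q.2 = K.endPos e) →
      (K.ceiling (f.shear q.1 q.2) ≤ K.floor (f.shear q.1 q.2) ∨
        K.ceiling (f.shear q'.1 q'.2) ≤ K.floor (f.shear q'.1 q'.2)) →
      f.zoneParam ha hab hb q = f.zoneParam ha hab hb q' := by
    rintro ⟨e, he⟩ hd
    have he' : f.shear q.1 q.2 = f.shear q'.1 q'.2 := by rw [hqq', he, f.map_endPos]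
    rw [← he', or_self] at hd
    exact zoneParam_eq_of_degenerate ha hab hb hc he' hd
  rcases le_or_gt (K.ceiling (f.shear q.1 q.2)) (K.floor (f.shear q.1 q.2)) with hd | hd
  · exact hdeg (K.exists_eq_endPos (f.shear_mem q.1.2 q.2.2) hd) (Or.inl hd)
  rcases le_or_gt (K.ceiling (f.shear q'.1 q'.2)) (K.floor (f.shear q'.1 q'.2)) with hd' | hd'
  · refine hdeg ?_ (Or.inr hd')
    obtain ⟨e, he⟩ := K.exists_eq_endPos (f.shear_mem q'.1.2 q'.2.2) hd'
    refine ⟨e, f.strictMonoOn.injOn (f.shear_mem q.1.2 q.2.2) (K.endPos_mem e) ?_⟩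
    rw [← hqq', he, f.map_endPos]
  have hs : (q.2 : ℝ) = 0 := by
    have : (q.2 : ℝ) * (K.ceiling (f.shear q.1 q.2) - K.floor (f.shear q.1 q.2)) = 0 := by
      linarith
    rcases mul_eq_zero.1 this with h | h <;> linarith
  have hs' : (q'.2 : ℝ) = 1 := by
    have : (1 - (q'.2 : ℝ)) * (K.ceiling (f.shear q'.1 q'.2) - K.floor (f.shear q'.1 q'.2)) = 0 := by
      linarith
    rcases mul_eq_zero.1 this with h | h <;> linarith
  have hx : (q.1 : ℝ) = q'.1 := by
    refine f.strictMonoOn.injOn q.1.2 q'.1.2 ?_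
    have := hqq'
    simp only [shear, hs, hs'] at this
    simpa using this.symm
  exact (f.zoneParam_eq_iff ha hab hb q q').2
    ⟨Subtype.ext hx, Or.inl (Or.inr (Or.inl ⟨Subtype.ext hs, Subtype.ext hs'⟩))⟩

theorem proj_square_eq (hc : PolesMatch K a b)
    {q q' : Icc K.first K.last × Icc (0 : ℝ) 1}
    (h : f.zoneParam ha hab hb q = f.zoneParam ha hab hb q') :
    K.proj f (f.square q) = K.proj f (f.square q') := by
  have harc : ∀ r r' : Icc K.first K.last × Icc (0 : ℝ) 1, r.1 = r'.1 → r.2 = 0 → r'.2 = 1 →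
      K.proj f (f.square r) = K.proj f (f.square r') := by
    rintro ⟨x, _⟩ ⟨_, _⟩ rfl rfl rfl
    refine Quot.sound (Identified.arc _ _ ?_ ?_ ?_) <;>
      simp [square_zero, square_one, shear]
  obtain ⟨hx, (hs | ⟨h0, h1⟩ | ⟨h1, h0⟩) | ⟨e, he, hp⟩⟩ := (f.zoneParam_eq_iff ha hab hb q q').1 h
  · rw [Prod.ext hx hs]
  · exact harc _ _ hx h0 h1
  · exact (harc _ _ hx.symm h0 h1).symm
  · have h1 : f.shear q.1 q.2 = K.endPos e := by rw [he, f.shear_endPos]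
    have h2 : f.shear q'.1 q'.2 = K.endPos e := by rw [← hx, he, f.shear_endPos]
    rcases (hc e).1 hp with hex | hdeg
    · refine Quot.sound (Identified.collapse e hex _ _ ⟨(f.square q).2, ?_⟩ ⟨(f.square q').2, ?_⟩)
      · rw [square_zero, h1]
      · rw [square_zero, h2]
    · rw [nontrivial_endSlice_iff, not_lt] at hdeg
      have hd := le_antisymm hdeg (K.floor_le_ceiling (K.endPos_mem e))
      have : f.square q = f.square q' := by
        refine Subtype.ext (plane_ext ?_ ?_)
        · rw [square_zero, square_zero, h1, h2]
        · rw [square_one, square_one, h1, h2, hd]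
          ring
      rw [this]

end ArcGluing

/-- The parametrization of the zone factors through the cell and then through its quotient, and the
resulting continuous bijection from a compact to a Hausdorff space is a homeomorphism. The shear is
trivial on end slices, so there the angle is affine in the planar height whatever the gluing `f`;
the stitching depends on this. -/
theorem exists_homeomorph_zone (f : K.ArcGluing) {a b : ℝ} (ha : -1 ≤ a) (hab : a < b)
    (hb : b ≤ 1) (hc : ArcGluing.PolesMatch K a b) :
    ∃ e : K.Manifold f ≃ₜ zone a b, ∀ s,
      (∀ p : K.carrier, p.1 ∈ K.endSlice s → (e (K.proj f p)).1 = zonePoint (endHeight a b s)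
        (Circle.exp (2 * Real.pi * ((p.1 1 - K.floor (K.endPos s)) /
          (K.ceiling (K.endPos s) - K.floor (K.endPos s)))))) ∧
      ∀ z, z ∈ K.loop f s ↔ (e z).1.2 = endHeight a b s := by
  have hsurj : Function.Surjective f.square := fun p => (f.exists_square_eq p).imp fun _ h => h.1
  have hquot : IsQuotientMap f.square :=
    f.continuous_square.isClosedMap.isQuotientMap f.continuous_square hsurj
  choose r hr using hsurj
  have hlift : ∀ q, f.zoneParam ha hab hb (r (f.square q)) = f.zoneParam ha hab hb q :=
    fun q => ArcGluing.zoneParam_eq_of_square_eq ha hab hb hc (hr _)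
  have hcont : Continuous fun p => f.zoneParam ha hab hb (r p) := by
    rw [hquot.continuous_iff]
    exact (f.continuous_zoneParam ha hab hb).congr fun q => (hlift q).symm
  let j : K.Manifold f → zone a b := Quot.lift (fun p => f.zoneParam ha hab hb (r p)) (by
    intro p p' hpp'
    rw [← hr p, ← hr p'] at hpp'
    cases hpp' with
    | arc _ _ h1 h2 h3 => exact ArcGluing.zoneParam_eq_of_arc ha hab hb hc h1 h2 h3
    | collapse s hs _ _ h1 h2 =>
      have h1' := h1.2
      have h2' := h2.2
      rw [f.square_zero] at h1' h2'
      have e1 := f.eq_endPos_of_shear (r p).1.2 (r p).2.2 h1'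
      have e2 := f.eq_endPos_of_shear (r p').1.2 (r p').2.2 h2'
      exact (f.zoneParam_eq_iff ha hab hb _ _).2 ⟨Subtype.ext (e1.trans e2.symm),
        Or.inr ⟨s, e1, (hc s).2 (Or.inl hs)⟩⟩)
  have hj : ∀ q, j (K.proj f (f.square q)) = f.zoneParam ha hab hb q := hlift
  have hjc : Continuous j := continuous_quot_lift _ hcont
  have hjb : Function.Bijective j := by
    constructor
    · rintro ⟨p⟩ ⟨p'⟩ h
      change j (K.proj f p) = j (K.proj f p') at h
      change K.proj f p = K.proj f p'
      rw [← hr p, ← hr p'] at h ⊢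
      rw [hj, hj] at h
      exact ArcGluing.proj_square_eq ha hab hb hc h
    · intro z
      obtain ⟨q, rfl⟩ := f.surjective_zoneParam ha hab hb z
      exact ⟨K.proj f (f.square q), hj q⟩
  refine ⟨Continuous.homeoOfEquivCompactToT2 (f := Equiv.ofBijective j hjb) hjc, fun s => ?_⟩
  have hfirst : ∀ p : K.carrier, p.1 ∈ K.endSlice s → (j (K.proj f p)).1 =
      zonePoint (endHeight a b s) (Circle.exp (2 * Real.pi * ((p.1 1 - K.floor (K.endPos s)) /
          (K.ceiling (K.endPos s) - K.floor (K.endPos s))))) := by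
    intro p hp
    obtain ⟨q, hq, hq2⟩ := f.exists_square_eq p
    rw [← hp.2, ← hq2, ← hq, hj]
    have h := hp.2
    rw [← hq, f.square_zero] at h
    have h1 := f.height_endPos (a := a) (b := b) s
    rw [← f.eq_endPos_of_shear q.1.2 q.2.2 h] at h1
    simp only [ArcGluing.zoneParam, h1]
  refine ⟨hfirst, fun z => ?_⟩
  change _ ↔ (j z).1.2 = _
  constructor
  · rintro ⟨p, hp, rfl⟩
    rw [hfirst p hp, zonePoint]
  · obtain ⟨p, rfl⟩ := Quot.exists_rep z
    intro h
    refine ⟨p, ⟨p.2, ?_⟩, rfl⟩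
    change (j (K.proj f p)).1.2 = _ at h
    rw [← hr p] at h ⊢
    rw [hj] at h
    have h := (f.height_eq_endHeight_iff hab).1 h
    rw [f.square_zero, h, f.shear_endPos]

/-- Normal form for attaching: the chosen loop is the equator and the cell lies below it, a
reflection being used when the loop is at the first end. -/
theorem exists_homeomorph_zone_equator (f : K.ArcGluing) {s : SweepEnd}
    (hs : ¬ K.IsExtremumEnd s) (hn : (K.endSlice s).Nontrivial) :
    ∃ a, -1 ≤ a ∧ a < 0 ∧ ∃ e : K.Manifold f ≃ₜ zone a 0,
      (∀ p : K.carrier, p.1 ∈ K.endSlice s → (e (K.proj f p)).1 = zonePoint 0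
        (Circle.exp (2 * Real.pi * ((p.1 1 - K.floor (K.endPos s)) /
          (K.ceiling (K.endPos s) - K.floor (K.endPos s)))))) ∧
      (∀ z, z ∈ K.loop f s ↔ (e z).1.2 = 0) ∧
      ∀ z, z ∈ K.manifoldBoundary f ↔ e z ∈ zoneBoundary a 0 := by
  classical
  have hbdry : ∀ {a b : ℝ}, -1 ≤ a → a ≤ 0 → 0 ≤ b → b ≤ 1 → ArcGluing.PolesMatch K a b →
      ∀ e : K.Manifold f ≃ₜ zone a b, (∀ s z, z ∈ K.loop f s ↔ (e z).1.2 = endHeight a b s) →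
      ∀ z, z ∈ K.manifoldBoundary f ↔ e z ∈ zoneBoundary a b := by
    intro a b ha ha0 hb0 hb hc e hl z
    have h1 : |a| = 1 ↔ a = -1 := by rw [abs_of_nonpos ha0, neg_eq_iff_eq_neg]
    have h2 : |b| = 1 ↔ b = 1 := by rw [abs_of_nonneg hb0]
    have hc1 := hc SweepEnd.first
    have hc2 := hc SweepEnd.last
    have hl1 := hl SweepEnd.first z
    have hl2 := hl SweepEnd.last z
    simp only [endHeight, h1, h2] at hc1 hc2 hl1 hl2
    simp only [manifoldBoundary, zoneBoundary, mem_ofPred_eq]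
    constructor
    · rintro ⟨_ | _, h3, h4, h5⟩
      · exact Or.inl ⟨hl1.1 h5, fun h => (hc1.1 h).elim h3 fun g => g h4⟩
      · exact Or.inr ⟨hl2.1 h5, fun h => (hc2.1 h).elim h3 fun g => g h4⟩
    · rintro (⟨h3, h4⟩ | ⟨h3, h4⟩)
      · exact ⟨SweepEnd.first, fun h => h4 (hc1.2 (Or.inl h)),
          not_not.1 fun h => h4 (hc1.2 (Or.inr h)), hl1.2 h3⟩
      · exact ⟨SweepEnd.last, fun h => h4 (hc2.2 (Or.inl h)),
          not_not.1 fun h => h4 (hc2.2 (Or.inr h)), hl2.2 h3⟩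
  -- Distance of an end from the equator: 1 produces a pole, and `1 / 2` stands for any latitude
  -- that leaves a genuine boundary circle.
  let c : SweepEnd → ℝ := fun s =>
    if K.IsExtremumEnd s ∨ ¬ (K.endSlice s).Nontrivial then 1 else 1 / 2
  have hc : ∀ s, c s = 1 ↔ K.IsExtremumEnd s ∨ ¬ (K.endSlice s).Nontrivial := fun s => by
    simp only [c]
    split_ifs with h
    · simpa using h
    · simp only [h, iff_false]
      norm_num
  have hc0 : ∀ s, 0 < c s ∧ c s ≤ 1 := fun s => by
    simp only [c]
    split_ifs <;> norm_num
  have hs' : ¬ (K.IsExtremumEnd s ∨ ¬ (K.endSlice s).Nontrivial) :=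
    not_or.2 ⟨hs, not_not.2 hn⟩
  cases s with
  | last =>
    obtain ⟨h0, h1⟩ := hc0 SweepEnd.first
    have hm : ArcGluing.PolesMatch K (-c SweepEnd.first) 0 := by
      rintro (_ | _)
      · rw [endHeight, abs_neg, abs_of_pos h0, hc]
      · simpa [endHeight] using hs'
    obtain ⟨e, he⟩ := K.exists_homeomorph_zone f (by linarith) (by linarith) zero_le_one hm
    exact ⟨-c SweepEnd.first, by linarith, by linarith, e, (he SweepEnd.last).1,
      (he SweepEnd.last).2, hbdry (by linarith) (by linarith) le_rfl zero_le_one hm e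
      fun s => (he s).2⟩
  | first =>
    obtain ⟨h0, h1⟩ := hc0 SweepEnd.last
    have hm : ArcGluing.PolesMatch K 0 (c SweepEnd.last) := by
      rintro (_ | _)
      · simpa [endHeight] using hs'
      · rw [endHeight, abs_of_pos h0, hc]
    obtain ⟨e, he⟩ := K.exists_homeomorph_zone f (by linarith) h0 h1 hm
    have hb := hbdry (by linarith) le_rfl h0.le h1 hm e fun s => (he s).2
    -- The existential packaging lets `-0` be rewritten to `0` inside the type of the homeomorphism.
    have key : ∃ e' : K.Manifold f ≃ₜ zone (-c SweepEnd.last) (-0),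
        (∀ z, (e' z).1 = ((e z).1.1, -(e z).1.2)) ∧
        ∀ z, z ∈ K.manifoldBoundary f ↔ e' z ∈ zoneBoundary (-c SweepEnd.last) (-0) :=
      ⟨e.trans (zoneReflection _ _), fun z => rfl, fun z => by
        rw [hb, ← zoneReflection_mem_zoneBoundary]
        rfl⟩
    rw [neg_zero] at key
    obtain ⟨e', he', hb'⟩ := key
    refine ⟨-c SweepEnd.last, by linarith, by linarith, e', fun p hp => ?_, fun z => ?_, hb'⟩
    · rw [he', (he SweepEnd.first).1 p hp]
      simp [zonePoint, endHeight]
    · rw [he', (he SweepEnd.first).2 z]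
      simp [endHeight]

end MorseCell

/-! ### Attaching zones along their equators -/

/-- Apply `H` to the longitude on every parallel. At a pole the longitude is irrelevant, so the map
is well defined, and continuity descends from the cylinder, of which the zone is a quotient. -/
theorem exists_zone_twist {a b : ℝ} (ha : -1 ≤ a) (hb : b ≤ 1) (H : Circle ≃ₜ Circle) :
    ∃ T : zone a b ≃ₜ zone a b, ∀ p : zone a b, ∀ θ, zonePoint p.1.2 θ = p.1 →
      (T p).1 = zonePoint p.1.2 (H θ) := by
  let β : Icc a b × Circle → zone a b := fun q => ⟨zonePoint q.1 q.2, zonePoint_mem ha hb q.1.2 _⟩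
  have hβ : Continuous β := Continuous.subtype_mk (continuous_zonePoint.comp
    ((continuous_subtype_val.comp continuous_fst).prodMk continuous_snd)) _
  have hβs : Function.Surjective β := fun p => by
    obtain ⟨θ, hθ⟩ := exists_zonePoint p
    exact ⟨(⟨p.1.2, p.2.2⟩, θ), Subtype.ext hθ⟩
  have hquot : IsQuotientMap β := hβ.isClosedMap.isQuotientMap hβ hβs
  choose r hr using fun p : zone a b => exists_zonePoint p
  let T : zone a b → zone a b :=
    fun p => ⟨zonePoint p.1.2 (H (r p)), zonePoint_mem ha hb p.2.2 _⟩
  have hiff : ∀ (p : zone a b) (t : ℝ) (θ θ' : Circle),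
      zonePoint p.1.2 (H θ) = zonePoint t (H θ') ↔ zonePoint p.1.2 θ = zonePoint t θ' := by
    intro p t θ θ'
    rw [zonePoint_eq_iff (ha.trans p.2.2.1) (p.2.2.2.trans hb),
      zonePoint_eq_iff (ha.trans p.2.2.1) (p.2.2.2.trans hb), H.injective.eq_iff]
  have hT : ∀ p : zone a b, ∀ θ, zonePoint p.1.2 θ = p.1 → (T p).1 = zonePoint p.1.2 (H θ) :=
    fun p θ hθ => (hiff p _ _ _).2 ((hr p).trans hθ.symm)
  have hTc : Continuous T := by
    rw [hquot.continuous_iff]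
    have h1 : Continuous fun q : Icc a b × Circle => β (q.1, H q.2) := by fun_prop
    refine h1.congr fun q => Subtype.ext ?_
    exact (hT (β q) q.2 rfl).symm
  have hTb : Function.Bijective T := by
    constructor
    · intro p p' h
      have h1 := (hiff p _ _ _).1 (Subtype.ext_iff.1 h)
      rw [hr, hr] at h1
      exact Subtype.ext h1
    · intro p
      refine ⟨⟨zonePoint p.1.2 (H.symm (r p)), zonePoint_mem ha hb p.2.2 _⟩, Subtype.ext ?_⟩
      rw [hT _ (H.symm (r p)) rfl, H.apply_symm_apply]
      exact hr p
  exact ⟨Continuous.homeoOfEquivCompactToT2 (f := Equiv.ofBijective T hTb) hTc, hT⟩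

/-- A subset that a chart to a zone identifies with the equator, as a circle. -/
noncomputable def equatorHomeomorph {X : Type} [TopologicalSpace X] {a : ℝ} (ha : -1 ≤ a)
    (ha₀ : a ≤ 0) (e : X ≃ₜ zone a 0) {L : Set X} (hL : ∀ x, x ∈ L ↔ (e x).1.2 = 0) :
    L ≃ₜ Circle where
  toFun x := ⟨(e x).1.1, by
    have h1 := (e x).2.1
    rw [(hL x).1 x.2] at h1
    have h2 : ‖(e x).1.1‖ = 1 := by nlinarith [norm_nonneg (e x).1.1]
    simpa [Submonoid.unitSphere] using h2⟩
  invFun θ := ⟨e.symm ⟨zonePoint 0 θ, zonePoint_mem ha zero_le_one ⟨ha₀, le_rfl⟩ θ⟩, by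
    rw [hL, e.apply_symm_apply]
    rfl⟩
  left_inv x := by
    refine Subtype.ext ?_
    change e.symm _ = x.1
    rw [e.symm_apply_eq]
    refine Subtype.ext (Prod.ext ?_ ((hL x).1 x.2).symm)
    simp [zonePoint]
  right_inv θ := Circle.ext (by simp [zonePoint])
  continuous_toFun := by
    refine Continuous.subtype_mk ?_ _
    fun_prop
  continuous_invFun := by
    refine Continuous.subtype_mk (e.symm.continuous.comp (Continuous.subtype_mk ?_ _)) _
    exact continuous_zonePoint.comp (by fun_prop : Continuous fun θ : Circle => ((0 : ℝ), θ))

theorem equatorHomeomorph_spec {X : Type} [TopologicalSpace X] {a : ℝ} (ha : -1 ≤ a)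
    (ha₀ : a ≤ 0) (e : X ≃ₜ zone a 0) {L : Set X} (hL : ∀ x, x ∈ L ↔ (e x).1.2 = 0) (x : L) :
    (e x).1 = zonePoint 0 (equatorHomeomorph ha ha₀ e hL x) := by
  refine Prod.ext ?_ ((hL x).1 x.2)
  change (e x).1.1 = (√(1 - 0 ^ 2) : ℝ) * (e x).1.1
  simp

/-- The equator is connected, being a circle, and the height `a / 2` separates it from the only
other possible boundary circle. -/
theorem isComponentOf_of_equator {X : Type} [TopologicalSpace X] {a : ℝ} (ha : -1 ≤ a)
    (ha₀ : a < 0) (e : X ≃ₜ zone a 0) {L B : Set X} (hL : ∀ x, x ∈ L ↔ (e x).1.2 = 0)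
    (hB : ∀ x, x ∈ B ↔ e x ∈ zoneBoundary a 0) : IsComponentOf L B := by
  have hLB : L ⊆ B := fun x hx => (hB x).2 (Or.inr ⟨(hL x).1 hx, zero_ne_one⟩)
  let c := equatorHomeomorph ha ha₀.le e hL
  have hLconn : IsPreconnected L := by
    have h := isPreconnected_range (continuous_subtype_val.comp c.symm.continuous)
    rwa [range_comp, c.symm.surjective.range_eq, image_univ, Subtype.range_val] at h
  refine ⟨c.symm 1, hLB (c.symm 1).2, Subset.antisymm ?_
    (hLconn.subset_connectedComponentIn (c.symm 1).2 hLB)⟩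
  have hcont : Continuous fun x => (e x).1.2 := by fun_prop
  have hsub := isPreconnected_connectedComponentIn (x := (c.symm 1).1) (F := B)
    |>.subset_left_of_subset_union (u := {x | a / 2 < (e x).1.2}) (v := {x | (e x).1.2 < a / 2})
    (isOpen_lt continuous_const hcont) (isOpen_lt hcont continuous_const)
    (Set.disjoint_left.2 fun x (h1 : a / 2 < (e x).1.2) (h2 : (e x).1.2 < a / 2) =>
      lt_asymm h1 h2)
    (fun x hx => by
      rcases (hB x).1 (connectedComponentIn_subset _ _ hx) with ⟨h, -⟩ | ⟨h, -⟩
      · exact Or.inr (by change (e x).1.2 < a / 2; linarith)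
      · exact Or.inl (by change a / 2 < (e x).1.2; linarith))
    ⟨c.symm 1, mem_connectedComponentIn (hLB (c.symm 1).2), by
      change a / 2 < (e _).1.2
      rw [(hL _).1 (c.symm 1).2]
      linarith⟩
  intro x hx
  rcases (hB x).1 (connectedComponentIn_subset _ _ hx) with ⟨h, -⟩ | ⟨h, -⟩
  · have : a / 2 < (e x).1.2 := hsub hx
    linarith
  · exact (hL x).2 h

/-- Reflecting the second zone upwards makes the two halves fit along the equator into `zone a
(-c)`; the halves meet only there, so nothing but the glued points is identified. -/
theorem isSurfaceWithBoundary_attached_of_compatible {X Y : Type} [TopologicalSpace X]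
    [TopologicalSpace Y] {a c : ℝ} (ha : -1 ≤ a) (ha₀ : a < 0) (hc : -1 ≤ c) (hc₀ : c < 0)
    (e₁ : X ≃ₜ zone a 0) (e₂ : Y ≃ₜ zone c 0) {S BX : Set X} {T BY : Set Y}
    (hS : ∀ x, x ∈ S ↔ (e₁ x).1.2 = 0) (hT : ∀ y, y ∈ T ↔ (e₂ y).1.2 = 0)
    (hBX : ∀ x, x ∈ BX ↔ e₁ x ∈ zoneBoundary a 0) (hBY : ∀ y, y ∈ BY ↔ e₂ y ∈ zoneBoundary c 0)
    (h : S ≃ₜ T) (hcomp : ∀ x : S, (e₁ x).1 = (e₂ (h x)).1) :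
    IsSurfaceWithBoundary (Attached h)
      ((fun x : X => (Quot.mk _ (Sum.inl x) : Attached h)) '' (BX \ S) ∪
        (fun y : Y => (Quot.mk _ (Sum.inr y) : Attached h)) '' (BY \ T)) := by
  have : CompactSpace X := e₁.symm.compactSpace
  have : CompactSpace Y := e₂.symm.compactSpace
  let j₁ : X → zone a (-c) := fun x =>
    ⟨(e₁ x).1, (e₁ x).2.1, (e₁ x).2.2.1, (e₁ x).2.2.2.trans (by linarith)⟩
  let j₂ : Y → zone a (-c) := fun y =>
    ⟨((e₂ y).1.1, -(e₂ y).1.2), by simpa using (e₂ y).2.1, by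
      have := (e₂ y).2.2.2
      change a ≤ -(e₂ y).1.2
      linarith, neg_le_neg (e₂ y).2.2.1⟩
  let j : Attached h → zone a (-c) := Quot.lift (Sum.elim j₁ j₂) (by
    rintro _ _ ⟨x⟩
    refine Subtype.ext (Prod.ext ?_ ?_)
    · change (e₁ x).1.1 = (e₂ (h x)).1.1
      rw [hcomp]
    · change (e₁ x).1.2 = -(e₂ (h x)).1.2
      rw [(hS _).1 x.2, (hT _).1 (h x).2, neg_zero])
  have hjc : Continuous j := continuous_quot_lift _ (by
    refine Continuous.sumElim ?_ ?_
    · exact Continuous.subtype_mk (by fun_prop) _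
    · exact Continuous.subtype_mk (by fun_prop) _)
  have hglue : ∀ x y, j₁ x = j₂ y →
      (Quot.mk _ (Sum.inl x) : Attached h) = Quot.mk _ (Sum.inr y) := by
    intro x y hxy
    have h0 : (e₁ x).1.1 = (e₂ y).1.1 := congrArg (fun p => p.1.1) hxy
    have h1 : (e₁ x).1.2 = -(e₂ y).1.2 := congrArg (fun p => p.1.2) hxy
    have h2 := (e₁ x).2.2.2
    have h3 := (e₂ y).2.2.2
    have hx : x ∈ S := (hS x).2 (by linarith)
    have hy : y = h ⟨x, hx⟩ := by
      refine e₂.injective (Subtype.ext ?_)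
      rw [← hcomp ⟨x, hx⟩]
      exact Prod.ext h0.symm (by simp only; linarith)
    rw [hy]
    exact Quot.sound (AttachRel.glue ⟨x, hx⟩)
  have hjb : Function.Bijective j := by
    constructor
    · rintro ⟨x | y⟩ ⟨x' | y'⟩ hxy
      · have h1 : (e₁ x).1 = (e₁ x').1 := congrArg (fun p => p.1) hxy
        rw [e₁.injective (Subtype.ext h1)]
      · exact hglue x y' hxy
      · exact (hglue x' y hxy.symm).symm
      · have h0 : (e₂ y).1.1 = (e₂ y').1.1 := congrArg (fun p => p.1.1) hxy
        have h1 : -(e₂ y).1.2 = -(e₂ y').1.2 := congrArg (fun p => p.1.2) hxy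
        rw [e₂.injective (Subtype.ext (Prod.ext h0 (neg_inj.1 h1)))]
    · intro p
      rcases le_total p.1.2 0 with hp | hp
      · refine ⟨Quot.mk _ (Sum.inl (e₁.symm ⟨p.1, p.2.1, p.2.2.1, hp⟩)), Subtype.ext ?_⟩
        change (e₁ _).1 = _
        rw [e₁.apply_symm_apply]
      · refine ⟨Quot.mk _ (Sum.inr (e₂.symm ⟨(p.1.1, -p.1.2), by simpa using p.2.1, ?_, ?_⟩)),
          Subtype.ext ?_⟩
        · change c ≤ -p.1.2
          linarith [p.2.2.2]
        · change -p.1.2 ≤ 0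
          linarith
        · change ((e₂ _).1.1, -(e₂ _).1.2) = _
          rw [e₂.apply_symm_apply, neg_neg]
  refine (isSurfaceWithBoundary_zone ha ha₀.le (by linarith) (by linarith)
    (by linarith)).of_homeomorph
    (Continuous.homeoOfEquivCompactToT2 (f := Equiv.ofBijective j hjb) hjc) fun z => ?_
  change _ ↔ j z ∈ zoneBoundary a (-c)
  constructor
  · rintro (⟨x, ⟨hx, hxS⟩, rfl⟩ | ⟨y, ⟨hy, hyT⟩, rfl⟩)
    · rcases (hBX x).1 hx with h1 | ⟨h1, -⟩
      · exact Or.inl h1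
      · exact absurd ((hS x).2 h1) hxS
    · rcases (hBY y).1 hy with ⟨h1, h2⟩ | ⟨h1, -⟩
      · refine Or.inr ⟨congrArg Neg.neg h1, fun h3 => h2 (by linarith)⟩
      · exact absurd ((hT y).2 h1) hyT
  · obtain ⟨x | y, rfl⟩ := Quot.exists_rep z
    · rintro (⟨h1, h2⟩ | ⟨h1, -⟩)
      · refine Or.inl ⟨x, ⟨(hBX x).2 (Or.inl ⟨h1, h2⟩), fun hx => ?_⟩, rfl⟩
        have h3 : (e₁ x).1.2 = a := h1
        rw [(hS x).1 hx] at h3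
        linarith
      · have h3 : (e₁ x).1.2 = -c := h1
        linarith [(e₁ x).2.2.2]
    · rintro (⟨h1, -⟩ | ⟨h1, h2⟩)
      · have h3 : -(e₂ y).1.2 = a := h1
        linarith [(e₂ y).2.2.2]
      · have h3 : -(e₂ y).1.2 = -c := h1
        refine Or.inr ⟨y, ⟨(hBY y).2 (Or.inl ⟨neg_inj.1 h3, fun h4 => h2 (by linarith)⟩),
          fun hy => ?_⟩, rfl⟩
        rw [(hT y).1 hy] at h3
        linarith

theorem isAttachingMap_of_equator {X Y : Type} [TopologicalSpace X]
    [TopologicalSpace Y] {a c : ℝ} (ha : -1 ≤ a) (ha₀ : a < 0) (hc : -1 ≤ c) (hc₀ : c < 0)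
    (e₁ : X ≃ₜ zone a 0) (e₂ : Y ≃ₜ zone c 0) {S BX : Set X} {T BY : Set Y}
    (hS : ∀ x, x ∈ S ↔ (e₁ x).1.2 = 0) (hT : ∀ y, y ∈ T ↔ (e₂ y).1.2 = 0)
    (hBX : ∀ x, x ∈ BX ↔ e₁ x ∈ zoneBoundary a 0) (hBY : ∀ y, y ∈ BY ↔ e₂ y ∈ zoneBoundary c 0)
    (h : S ≃ₜ T) : IsAttachingMap BX BY h := by
  refine ⟨isComponentOf_of_equator ha ha₀ e₁ hS hBX, isComponentOf_of_equator hc hc₀ e₂ hT hBY, ?_⟩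
  let c₁ := equatorHomeomorph ha ha₀.le e₁ hS
  let c₂ := equatorHomeomorph hc hc₀.le e₂ hT
  -- Twisting the first zone by `h`, read as a map of circles, turns the gluing into the identity of
  -- the equator.
  obtain ⟨R, hR⟩ := exists_zone_twist ha zero_le_one (c₁.symm.trans (h.trans c₂))
  have hR2 : ∀ p, (R p).1.2 = p.1.2 := fun p => by
    obtain ⟨θ, hθ⟩ := exists_zonePoint p
    rw [hR p θ hθ, zonePoint]
  refine isSurfaceWithBoundary_attached_of_compatible ha ha₀ hc hc₀ (e₁.trans R) e₂
    (fun x => ?_) hT (fun x => ?_) hBY h fun x => ?_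
  · change _ ↔ (R (e₁ x)).1.2 = 0
    rw [hR2, hS]
  · change _ ↔ R (e₁ x) ∈ zoneBoundary a 0
    rw [hBX]
    simp only [zoneBoundary, mem_ofPred_eq, hR2]
  · change (R (e₁ x)).1 = _
    have h1 := equatorHomeomorph_spec ha ha₀.le e₁ hS x
    have h0 : (e₁ x).1.2 = 0 := (hS x).1 x.2
    rw [hR _ (c₁ x) (by rw [h0, h1]), equatorHomeomorph_spec hc hc₀.le e₂ hT (h x), h0]
    congr 1
    change c₂ (h (c₁.symm (c₁ x))) = _
    rw [c₁.symm_apply_apply]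

/-! ### Circle homeomorphisms with a prescribed germ -/

theorem exists_circle_homeomorph_of_le_one {κ : ℝ} (hκ : 0 < κ) (hκ₁ : κ ≤ 1) :
    ∃ k : Circle ≃ₜ Circle, ∃ ε > 0, ∀ α : ℝ, |α| ≤ ε → k (Circle.exp α) = Circle.exp (κ * α) := by
  -- A piecewise linear increasing map fixing 0 and 1, of slope `κ` on the first and last quarters,
  -- with a line of slope 2 bridging the middle. Here `κ ≤ 1` keeps the lower line below the upper
  -- one. A quarter of the circumference accounts for the radius `Real.pi / 2` below.
  let g : ℝ → ℝ := fun s => min (max (κ * s) (1 / 2 + 2 * (s - 1 / 2))) (1 - κ * (1 - s))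
  have hgmono : StrictMono g := by
    intro x y hxy
    simp only [g]
    have h := mul_lt_mul_of_pos_left hxy hκ
    exact min_lt_min (max_lt_max h (by linarith)) (by linarith)
  have hgc : Continuous g := by fun_prop
  have hlow : ∀ s ∈ Icc (0 : ℝ) (1 / 4), g s = κ * s := by
    intro s hs
    simp only [g]
    have := mul_nonneg hκ.le hs.1
    rw [max_eq_left (by linarith [hs.2]), min_eq_left (by linarith)]
  have hhigh : ∀ s ∈ Icc (3 / 4 : ℝ) 1, g s = 1 - κ * (1 - s) := by
    intro s hs
    simp only [g]
    have := mul_nonneg hκ.le (sub_nonneg.2 hs.2)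
    exact min_eq_right (le_max_of_le_right (by linarith [hs.1]))
  have hg0 : g 0 = 0 := by rw [hlow 0 (by norm_num), mul_zero]
  have hg1 : g 1 = 1 := by rw [hhigh 1 (by norm_num), sub_self, mul_zero, sub_zero]
  have hgI : ∀ s ∈ Icc (0 : ℝ) 1, g s ∈ Icc (0 : ℝ) 1 := fun s hs =>
    ⟨hg0.symm.trans_le (hgmono.monotone hs.1), (hgmono.monotone hs.2).trans_eq hg1⟩
  have hiff : ∀ s ∈ Icc (0 : ℝ) 1, ∀ s' ∈ Icc (0 : ℝ) 1,
      (Circle.exp (2 * Real.pi * g s) = Circle.exp (2 * Real.pi * g s') ↔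
        Circle.exp (2 * Real.pi * s) = Circle.exp (2 * Real.pi * s')) := by
    intro s hs s' hs'
    have e0 : ∀ t, g t = 0 ↔ t = 0 := fun t => by
      simpa only [hg0] using hgmono.injective.eq_iff (a := t) (b := 0)
    have e1 : ∀ t, g t = 1 ↔ t = 1 := fun t => by
      simpa only [hg1] using hgmono.injective.eq_iff (a := t) (b := 1)
    rw [circle_exp_two_pi_mul_eq_iff (hgI s hs) (hgI s' hs'), circle_exp_two_pi_mul_eq_iff hs hs',
      hgmono.injective.eq_iff, e0, e1, e0, e1]
  choose r hr hrθ using exists_circle_exp_two_pi_mul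
  let E : Icc (0 : ℝ) 1 → Circle := fun s => Circle.exp (2 * Real.pi * s)
  have hE : Continuous E := by fun_prop
  have hquot : IsQuotientMap E := hE.isClosedMap.isQuotientMap hE
    fun θ => ⟨⟨r θ, hr θ⟩, hrθ θ⟩
  let k : Circle → Circle := fun θ => Circle.exp (2 * Real.pi * g (r θ))
  have hk : ∀ s ∈ Icc (0 : ℝ) 1, k (Circle.exp (2 * Real.pi * s)) =
      Circle.exp (2 * Real.pi * g s) := fun s hs =>
    (hiff _ (hr _) _ hs).2 (hrθ _)
  have hkc : Continuous k := by
    rw [hquot.continuous_iff]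
    have h1 : Continuous fun s : Icc (0 : ℝ) 1 => Circle.exp (2 * Real.pi * g s) := by fun_prop
    exact h1.congr fun s => (hk s s.2).symm
  have hkb : Function.Bijective k := by
    constructor
    · intro θ θ' h
      have := (hiff _ (hr _) _ (hr _)).1 h
      rwa [hrθ, hrθ] at this
    · intro θ
      obtain ⟨s, hs, hsθ⟩ : r θ ∈ g '' Icc 0 1 := by
        refine intermediate_value_Icc zero_le_one hgc.continuousOn ?_
        rw [hg0, hg1]
        exact hr θ
      refine ⟨Circle.exp (2 * Real.pi * s), ?_⟩
      rw [hk s hs, hsθ, hrθ]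
  have hpi := Real.pi_pos
  refine ⟨Continuous.homeoOfEquivCompactToT2 (f := Equiv.ofBijective k hkb) hkc, Real.pi / 2,
    by positivity, fun α hα => ?_⟩
  change k _ = _
  obtain ⟨h1, h2⟩ := abs_le.1 hα
  rcases le_total 0 α with h | h
  · have hs : α / (2 * Real.pi) ∈ Icc (0 : ℝ) (1 / 4) :=
      ⟨by positivity, by rw [div_le_iff₀ (by positivity)]; linarith⟩
    have h3 := hk _ ⟨hs.1, hs.2.trans (by norm_num)⟩
    rw [hlow _ hs] at h3
    rwa [mul_left_comm, mul_div_cancel₀ _ (by positivity)] at h3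
  · have hs : 1 + α / (2 * Real.pi) ∈ Icc (3 / 4 : ℝ) 1 := by
      have h3 : -(1 / 4) ≤ α / (2 * Real.pi) := by
        rw [le_div_iff₀ (by positivity)]
        linarith
      have h4 : α / (2 * Real.pi) ≤ 0 := div_nonpos_of_nonpos_of_nonneg h (by positivity)
      constructor <;> linarith
    have h3 := hk _ ⟨by linarith [hs.1], hs.2⟩
    rw [hhigh _ hs] at h3
    have e1 : 2 * Real.pi * (1 + α / (2 * Real.pi)) = α + 2 * Real.pi := by
      field_simp
      ring
    have e2 : 2 * Real.pi * (1 - κ * (1 - (1 + α / (2 * Real.pi)))) = κ * α + 2 * Real.pi := by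
      field_simp
      ring
    rwa [e1, e2, Circle.exp_add_two_pi, Circle.exp_add_two_pi] at h3

theorem exists_circle_homeomorph {κ : ℝ} (hκ : 0 < κ) :
    ∃ k : Circle ≃ₜ Circle, ∃ ε > 0, ∀ α : ℝ, |α| ≤ ε → k (Circle.exp α) = Circle.exp (κ * α) := by
  rcases le_total κ 1 with h | h
  · exact exists_circle_homeomorph_of_le_one hκ h
  · obtain ⟨k, ε, hε, hk⟩ :=
      exists_circle_homeomorph_of_le_one (inv_pos.2 hκ) (inv_le_one_of_one_le₀ h)
    refine ⟨k.symm, ε / κ, by positivity, fun α hα => ?_⟩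
    rw [k.symm_apply_eq, hk _ ?_, inv_mul_cancel_left₀ hκ.ne']
    rw [abs_mul, abs_of_pos hκ]
    rwa [le_div_iff₀' hκ] at hα

/-! ### Critical points on the slice shared by two cells -/

theorem continuous_plane_apply (i : Fin 2) : Continuous fun p : Plane => p i :=
  PiLp.continuous_apply 2 _ i

/-- Regularity is open along the frontier: near a regular point the same `φ` serves, since points
strictly off its graph have a neighbourhood inside `A` or outside `A` and so cannot be frontier
points. -/
theorem isClosed_setOf_isCriticalPoint (A : Set Plane) : IsClosed {p | IsCriticalPoint A p} := by
  rw [← isOpen_compl_iff, isOpen_iff_eventually]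
  intro p hp
  by_cases hpA : p ∈ frontier A
  · have hreg : IsRegularBoundaryPoint A p := by
      by_contra h
      exact hp ⟨hpA, h⟩
    obtain ⟨φ, hφ, -, h⟩ := hreg
    have hc : Continuous fun q : Plane => φ (q 0) := hφ.comp (continuous_plane_apply 0)
    have hmem : ∀ q, (∀ᶠ z in 𝓝 q, z ∈ A) → q ∉ frontier A := fun q h h' =>
      h'.2 (mem_interior_iff_mem_nhds.2 h)
    have hnmem : ∀ q, (∀ᶠ z in 𝓝 q, z ∉ A) → q ∉ frontier A := fun q h h' =>
      mem_closure_iff_frequently.1 h'.1 h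
    rcases h with h | h
    · filter_upwards [h.eventually_nhds] with q hq hcrit
      refine hcrit.2 ⟨φ, hφ, ?_, Or.inl hq⟩
      rcases lt_trichotomy (φ (q 0)) (q 1) with hlt | heq | hgt
      · refine absurd hcrit.1 (hmem q ?_)
        filter_upwards [hq, hc.continuousAt.eventually_lt
          (continuous_plane_apply 1).continuousAt hlt] with z hz hz'
        exact hz.2 hz'.le
      · exact heq
      · refine absurd hcrit.1 (hnmem q ?_)
        filter_upwards [hq, (continuous_plane_apply 1).continuousAt.eventually_lt
          hc.continuousAt hgt] with z hz hz'
        rw [hz]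
        exact hz'.not_ge
    · filter_upwards [h.eventually_nhds] with q hq hcrit
      refine hcrit.2 ⟨φ, hφ, ?_, Or.inr hq⟩
      rcases lt_trichotomy (φ (q 0)) (q 1) with hlt | heq | hgt
      · refine absurd hcrit.1 (hnmem q ?_)
        filter_upwards [hq, hc.continuousAt.eventually_lt
          (continuous_plane_apply 1).continuousAt hlt] with z hz hz'
        rw [hz]
        exact hz'.not_ge
      · exact heq
      · refine absurd hcrit.1 (hmem q ?_)
        filter_upwards [hq, (continuous_plane_apply 1).continuousAt.eventually_lt
          hc.continuousAt hgt] with z hz hz'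
        exact hz.2 hz'.le
  · filter_upwards [isClosed_frontier.isOpen_compl.mem_nhds hpA] with q hq hcrit
    exact hq hcrit.1

namespace MorseCell

variable {A : Set Plane}

/-- Approach `p` along the curve that keeps a fixed ratio between floor and ceiling. -/
theorem frequently_mem_carrier (K : MorseCell A) {s : SweepEnd} {p : Plane}
    (hp : p ∈ K.endSlice s) :
    ∃ᶠ q in 𝓝 p, q ∈ A ∧ q 0 ∈ Ioo K.first K.last := by
  obtain ⟨⟨hx, hy⟩, hps⟩ := hp
  obtain ⟨s', t, hs', ht, hst, h⟩ := (segment_eq_Icc (K.floor_le_ceiling hx)).symm ▸ hy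
  let γ : ℝ → Plane := fun x => !₂[x, s' * K.floor x + t * K.ceiling x]
  have hγc : ContinuousOn γ (Icc K.first K.last) := by
    refine (PiLp.continuous_toLp 2 _).comp_continuousOn (continuousOn_pi.2 fun i => ?_)
    fin_cases i
    · exact continuousOn_id
    · exact (continuousOn_const.mul K.continuousOn_floor).add
        (continuousOn_const.mul K.continuousOn_ceiling)
  have hγp : γ (p 0) = p := plane_ext (by simp [γ]) (by simpa [γ] using h)
  have hγ : Tendsto γ (𝓝[Ioo K.first K.last] (p 0)) (𝓝 p) := by
    have := ((hγc _ hx).mono Ioo_subset_Icc_self).tendsto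
    rwa [hγp] at this
  have : (𝓝[Ioo K.first K.last] (p 0)).NeBot := by
    rw [← mem_closure_iff_nhdsWithin_neBot, closure_Ioo K.first_lt_last.ne]
    exact hx
  refine hγ.frequently (Eventually.frequently ?_)
  filter_upwards [self_mem_nhdsWithin] with x hx'
  have hle := K.floor_le_ceiling (Ioo_subset_Icc_self hx')
  have h1 : (γ x) 0 = x := by simp [γ]
  have h2 : (γ x) 1 = s' * K.floor x + t * K.ceiling x := by simp [γ]
  refine ⟨K.subset_region _ ?_ ?_, ?_⟩
  · rw [h1]
    exact Ioo_subset_Icc_self hx'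
  · rw [h1, h2, show s' = 1 - t by linarith]
    constructor <;> nlinarith
  · rwa [h1]

theorem AttachedAlong.symm {K₁ K₂ : MorseCell A} {s₁ s₂ : SweepEnd}
    (h : K₁.AttachedAlong s₁ K₂ s₂) : K₂.AttachedAlong s₂ K₁ s₁ :=
  ⟨h.1.symm, h.2.1.symm, by rw [inter_comm]; exact h.2.2⟩

/-- The other cell accumulates at a shared point from the far side of the slice. -/
theorem AttachedAlong.not_isExtremumEnd {K₁ K₂ : MorseCell A} {s₁ s₂ : SweepEnd}
    (h : K₁.AttachedAlong s₁ K₂ s₂) : ¬ K₁.IsExtremumEnd s₁ := by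
  intro hex
  obtain ⟨hne, hpos, p, ⟨hp₁, hp₂⟩, -⟩ := h
  have hfr := K₂.frequently_mem_carrier hp₂
  cases s₁ <;> cases s₂ <;> simp only [endPos, ne_eq, not_true_eq_false] at hne hpos
  · obtain ⟨q, ⟨hqA, hq⟩, hq'⟩ := (hfr.and_eventually (hex.filter_mono (nhds_le_nhdsSet hp₁))).exists
    linarith [hq' hqA, hq.2]
  · obtain ⟨q, ⟨hqA, hq⟩, hq'⟩ := (hfr.and_eventually (hex.filter_mono (nhds_le_nhdsSet hp₁))).exists
    linarith [hq' hqA, hq.1]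

theorem isSaddlePoint_of_mem_endSlice {K₁ K₂ : MorseCell A} {s₁ s₂ : SweepEnd} (hne : s₁ ≠ s₂)
    {p : Plane} (hp₁ : p ∈ K₁.endSlice s₁) (hp₂ : p ∈ K₂.endSlice s₂) (hp : IsCriticalPoint A p) :
    IsSaddlePoint A p := by
  refine ⟨hp, ?_⟩
  have key : ∀ {K L : MorseCell A}, p ∈ K.endSlice SweepEnd.first → p ∈ L.endSlice SweepEnd.last →
      ¬ IsLocalExtrOn (fun q : Plane => q 0) A p := by
    rintro K L hK hL (h | h)
    · obtain ⟨q, ⟨hqA, hq⟩, hq'⟩ := ((L.frequently_mem_carrier hL).and_eventually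
        (eventually_nhdsWithin_iff.1 h)).exists
      have h1 := hq' hqA
      have h2 := hL.2
      simp only [endPos] at h1 h2
      linarith [hq.2]
    · obtain ⟨q, ⟨hqA, hq⟩, hq'⟩ := ((K.frequently_mem_carrier hK).and_eventually
        (eventually_nhdsWithin_iff.1 h)).exists
      have h1 := hq' hqA
      have h2 := hK.2
      simp only [endPos] at h1 h2
      linarith [hq.1]
  cases s₁ <;> cases s₂
  · exact absurd rfl hne
  · exact key hp₁ hp₂
  · exact key hp₂ hp₁
  · exact absurd rfl hne

theorem eventually_mem_region (K : MorseCell A) {p : Plane} (hx : p 0 ∈ Icc K.first K.last)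
    (hy : p 1 ∈ Ioo (K.floor (p 0)) (K.ceiling (p 0))) :
    ∀ᶠ q in 𝓝 p, q 0 ∈ Icc K.first K.last → q ∈ A := by
  have hS : MapsTo (fun q : Plane => q 0) {q | q 0 ∈ Icc K.first K.last} (Icc K.first K.last) :=
    fun q hq => hq
  have h0 := (continuous_plane_apply 0).continuousWithinAt (s := {q | q 0 ∈ Icc K.first K.last})
    (x := p)
  have h1 := (continuous_plane_apply 1).continuousWithinAt (s := {q | q 0 ∈ Icc K.first K.last})
    (x := p)
  have hf := (K.continuousOn_floor _ hx).comp (f := fun q : Plane => q 0) h0 hS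
  have hc := (K.continuousOn_ceiling _ hx).comp (f := fun q : Plane => q 0) h0 hS
  refine (eventually_nhdsWithin_iff (s := {q : Plane | q 0 ∈ Icc K.first K.last})).1 ?_
  filter_upwards [hf.eventually_lt h1 hy.1, h1.eventually_lt hc hy.2, self_mem_nhdsWithin]
    with q h2 h3 h4
  exact K.subset_region q h4 ⟨h2.le, h3.le⟩

/-- Each cell supplies one half of a neighbourhood, on its own side of the slice. -/
theorem mem_interior_of_endSlices {K₁ K₂ : MorseCell A} {s₁ s₂ : SweepEnd} (hne : s₁ ≠ s₂)
    (hpos : K₁.endPos s₁ = K₂.endPos s₂) {p : Plane} (hp : p 0 = K₁.endPos s₁)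
    (h₁ : p 1 ∈ Ioo (K₁.floor (p 0)) (K₁.ceiling (p 0)))
    (h₂ : p 1 ∈ Ioo (K₂.floor (p 0)) (K₂.ceiling (p 0))) : p ∈ interior A := by
  have hp' : p 0 = K₂.endPos s₂ := hp.trans hpos
  have key : ∀ {K L : MorseCell A}, p 0 = K.first → p 0 = L.last →
      ∀ᶠ q in 𝓝 p, q 0 ∈ Icc K.first K.last ∨ q 0 ∈ Icc L.first L.last := by
    intro K L hK hL
    have h1 : p 0 < K.last := hK ▸ K.first_lt_last
    have h2 : L.first < p 0 := hL ▸ L.first_lt_last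
    filter_upwards [(continuous_plane_apply 0).continuousAt.eventually_lt_const h1,
      (continuous_plane_apply 0).continuousAt.eventually_const_lt h2] with q h3 h4
    rcases le_total (q 0) (p 0) with h | h
    · exact Or.inr ⟨h4.le, h.trans hL.le⟩
    · exact Or.inl ⟨hK.ge.trans h, h3.le⟩
  have hor : ∀ᶠ q in 𝓝 p, q 0 ∈ Icc K₁.first K₁.last ∨ q 0 ∈ Icc K₂.first K₂.last := by
    cases s₁ <;> cases s₂
    · exact absurd rfl hne
    · exact key hp hp'
    · exact (key hp' hp).mono fun _ => Or.symm
    · exact absurd rfl hne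
  rw [mem_interior_iff_mem_nhds]
  filter_upwards [hor, K₁.eventually_mem_region (hp ▸ K₁.endPos_mem s₁) h₁,
    K₂.eventually_mem_region (hp' ▸ K₂.endPos_mem s₂) h₂] with q hq hq₁ hq₂
  exact hq.elim hq₁ hq₂

theorem mem_endSlices_of_mem_carriers {K₁ K₂ : MorseCell A} {s₁ s₂ : SweepEnd} (hne : s₁ ≠ s₂)
    (hpos : K₁.endPos s₁ = K₂.endPos s₂) {p : Plane} (h₁ : p ∈ K₁.carrier) (h₂ : p ∈ K₂.carrier) :
    p ∈ K₁.endSlice s₁ ∧ p ∈ K₂.endSlice s₂ := by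
  suffices p 0 = K₁.endPos s₁ from ⟨⟨h₁, this⟩, ⟨h₂, this.trans hpos⟩⟩
  have h1 := h₁.1
  have h2 := h₂.1
  cases s₁ <;> cases s₂ <;> simp only [endPos, ne_eq, not_true_eq_false] at hne hpos ⊢
  · exact le_antisymm (h2.2.trans hpos.ge) h1.1
  · exact le_antisymm h1.2 (hpos.trans_le h2.1)

/-- Two such points would be saddles, and the points strictly between them lie strictly inside both
end slices, hence in the interior of `A`. Uniqueness matters: if both ends of one slice were
critical but the other slice were longer, one point of the first loop would have to go to two points
of the second. -/
theorem critical_subsingleton (hgen : SweepInGeneralPosition A) {K₁ K₂ : MorseCell A}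
    {s₁ s₂ : SweepEnd} (hne : s₁ ≠ s₂) (hpos : K₁.endPos s₁ = K₂.endPos s₂) :
    {p | p ∈ K₁.carrier ∧ p ∈ K₂.carrier ∧ IsCriticalPoint A p}.Subsingleton := by
  suffices H : ∀ p p' : Plane, p ∈ K₁.carrier → p ∈ K₂.carrier → IsCriticalPoint A p →
      p' ∈ K₁.carrier → p' ∈ K₂.carrier → IsCriticalPoint A p' → p 1 < p' 1 → p = p' by
    rintro p ⟨h₁, h₂, hc⟩ p' ⟨h₁', h₂', hc'⟩
    have hp := (mem_endSlices_of_mem_carriers hne hpos h₁ h₂).1.2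
    have hp' := (mem_endSlices_of_mem_carriers hne hpos h₁' h₂').1.2
    rcases lt_trichotomy (p 1) (p' 1) with h | h | h
    · exact H p p' h₁ h₂ hc h₁' h₂' hc' h
    · exact plane_ext (hp.trans hp'.symm) h
    · exact (H p' p h₁' h₂' hc' h₁ h₂ hc h).symm
  intro p p' h₁ h₂ hc h₁' h₂' hc' hlt
  obtain ⟨e₁, e₂⟩ := mem_endSlices_of_mem_carriers hne hpos h₁ h₂
  obtain ⟨e₁', e₂'⟩ := mem_endSlices_of_mem_carriers hne hpos h₁' h₂'
  have hpp' : p 0 = p' 0 := e₁.2.trans e₁'.2.symm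
  refine hgen p p' (isSaddlePoint_of_mem_endSlice hne e₁ e₂ hc)
    (isSaddlePoint_of_mem_endSlice hne e₁' e₂' hc') hpp' ?_
  rintro q ⟨α, β, hα, hβ, hαβ, rfl⟩
  have hq0 : (α • p + β • p') 0 = p 0 := by
    simp only [PiLp.add_apply, PiLp.smul_apply, smul_eq_mul, ← hpp']
    rw [← add_mul, hαβ, one_mul]
  have hq1 : (α • p + β • p') 1 ∈ Ioo (p 1) (p' 1) := by
    simp only [PiLp.add_apply, PiLp.smul_apply, smul_eq_mul]
    obtain rfl : α = 1 - β := by linarith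
    constructor <;> nlinarith
  refine mem_interior_of_endSlices hne hpos (hq0.trans e₁.2) ?_ ?_
  · rw [hq0]
    exact ⟨h₁.2.1.trans_lt hq1.1, hq1.2.trans_le (hpp' ▸ h₁'.2.2)⟩
  · rw [hq0]
    exact ⟨h₂.2.1.trans_lt hq1.1, hq1.2.trans_le (hpp' ▸ h₂'.2.2)⟩

/-- The stitched points of the shared slice concentrate at a single point of it. -/
theorem exists_stitching_center (hgen : SweepInGeneralPosition A) {K₁ K₂ : MorseCell A}
    {s₁ s₂ : SweepEnd} (hne : s₁ ≠ s₂) (hpos : K₁.endPos s₁ = K₂.endPos s₂) :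
    ∃ c : ℝ, ∀ δ > 0, ∃ r > 0, ∀ p q : Plane, p ∈ K₁.carrier → p ∈ K₂.carrier →
      IsCriticalPoint A q → p ∈ Metric.ball q r → |p 1 - c| < δ := by
  obtain ⟨c, hc⟩ : ∃ c : ℝ, ∀ p ∈ K₁.carrier, p ∈ K₂.carrier → IsCriticalPoint A p → p 1 = c := by
    by_cases h : ∃ p, p ∈ K₁.carrier ∧ p ∈ K₂.carrier ∧ IsCriticalPoint A p
    · obtain ⟨p, hp⟩ := h
      exact ⟨p 1, fun q h₁ h₂ hq =>
        congrArg (fun z : Plane => z 1) (critical_subsingleton hgen hne hpos ⟨h₁, h₂, hq⟩ hp)⟩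
    · exact ⟨0, fun p h₁ h₂ hp => absurd ⟨p, h₁, h₂, hp⟩ h⟩
  refine ⟨c, fun δ hδ => ?_⟩
  -- Shared points at height at least `δ` away from `c` form a compact set disjoint from the closed
  -- set of all critical points, so the two have disjoint thickenings. This also covers balls
  -- centred at critical points outside the shared slice.
  have hcomp : IsCompact (K₁.carrier ∩ K₂.carrier ∩ {p | δ ≤ |p 1 - c|}) := by
    refine (K₁.isCompact_carrier.inter K₂.isCompact_carrier).inter_right ?_
    exact isClosed_le continuous_const
      (((continuous_plane_apply 1).sub continuous_const).abs)
  have hdisj : Disjoint (K₁.carrier ∩ K₂.carrier ∩ {p | δ ≤ |p 1 - c|})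
      {p | IsCriticalPoint A p} := by
    refine Set.disjoint_left.2 ?_
    rintro p ⟨⟨h₁, h₂⟩, h3⟩ hp
    have h3 : δ ≤ |p 1 - c| := h3
    rw [hc p h₁ h₂ hp, sub_self, abs_zero] at h3
    exact h3.not_gt hδ
  obtain ⟨r, hr, hr'⟩ := hdisj.exists_thickenings hcomp (isClosed_setOf_isCriticalPoint A)
  refine ⟨r, hr, fun p q h₁ h₂ hq hpq => ?_⟩
  by_contra h
  push Not at h
  exact Set.disjoint_left.1 hr' (Metric.self_subset_thickening hr _ ⟨⟨h₁, h₂⟩, h⟩)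
    (Metric.mem_thickening_iff.2 ⟨q, hq, hpq⟩)

end MorseCell

/-! ### The attaching map and its stitching -/

theorem theorem1 (A : Set Plane) (hA : IsCompact A) (hgen : SweepInGeneralPosition A)
    (K₁ K₂ : MorseCell A) (f₁ : K₁.ArcGluing) (f₂ : K₂.ArcGluing) (s₁ s₂ : SweepEnd)
    (hatt : K₁.AttachedAlong s₁ K₂ s₂) :
    IsSurfaceWithBoundary (K₁.Manifold f₁) (K₁.manifoldBoundary f₁) ∧
    IsSurfaceWithBoundary (K₂.Manifold f₂) (K₂.manifoldBoundary f₂) ∧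
    ∃ h : K₁.loop f₁ s₁ ≃ₜ K₂.loop f₂ s₂,
      IsAttachingMap (K₁.manifoldBoundary f₁) (K₂.manifoldBoundary f₂) h ∧
      ∃ r > 0, ∀ (z₁ : K₁.loop f₁ s₁) (z₂ : K₂.loop f₂ s₂),
        K₁.Stitched f₁ K₂ f₂ r z₁ z₂ → h z₁ = z₂ := by
  have hne := hatt.1
  have hpos := hatt.2.1
  have hn₁ : (K₁.endSlice s₁).Nontrivial := hatt.2.2.mono inter_subset_left
  have hn₂ : (K₂.endSlice s₂).Nontrivial := hatt.2.2.mono inter_subset_right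
  obtain ⟨a, ha, ha₀, e₁, hp₁, hl₁, hb₁⟩ :=
    K₁.exists_homeomorph_zone_equator f₁ hatt.not_isExtremumEnd hn₁
  obtain ⟨b, hb, hb₀, e₂, hp₂, hl₂, hb₂⟩ :=
    K₂.exists_homeomorph_zone_equator f₂ hatt.symm.not_isExtremumEnd hn₂
  refine ⟨(isSurfaceWithBoundary_zone ha ha₀.le ha₀ le_rfl zero_le_one).of_homeomorph e₁ hb₁,
    (isSurfaceWithBoundary_zone hb hb₀.le hb₀ le_rfl zero_le_one).of_homeomorph e₂ hb₂, ?_⟩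
  let c₁ := equatorHomeomorph ha ha₀.le e₁ hl₁
  let c₂ := equatorHomeomorph hb hb₀.le e₂ hl₂
  set l₁ := K₁.floor (K₁.endPos s₁)
  set l₂ := K₂.floor (K₂.endPos s₂)
  set w₁ := K₁.ceiling (K₁.endPos s₁) - l₁
  set w₂ := K₂.ceiling (K₂.endPos s₂) - l₂
  have hw₁ : 0 < w₁ := sub_pos.2 ((K₁.nontrivial_endSlice_iff s₁).1 hn₁)
  have hw₂ : 0 < w₂ := sub_pos.2 ((K₂.nontrivial_endSlice_iff s₂).1 hn₂)
  have hzero : ∀ θ θ' : Circle, zonePoint 0 θ = zonePoint 0 θ' → θ = θ' := by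
    intro θ θ' h
    simpa using ((zonePoint_eq_iff (by norm_num) zero_le_one).1 h).2
  obtain ⟨c, hc⟩ := MorseCell.exists_stitching_center hgen hne hpos
  -- A planar displacement `d` along the slice is the angle `2 * π * d / w₁` on one loop and `2 * π
  -- * d / w₂` on the other, whence the factor `w₁ / w₂`.
  obtain ⟨k, ε, hε, hk⟩ := exists_circle_homeomorph (div_pos hw₁ hw₂)
  have hpi := Real.pi_pos
  -- This distance from `c` is the angle `ε` on the first loop, the range in which `k` is linear.
  obtain ⟨r, hr, hr'⟩ := hc (ε * w₁ / (2 * Real.pi)) (by positivity)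
  -- Rotate the angle of height `c` to 0, rescale by `k`, then rotate 0 to the angle of `c` on the
  -- second loop.
  let h : K₁.loop f₁ s₁ ≃ₜ K₂.loop f₂ s₂ :=
    c₁.trans ((Homeomorph.mulLeft (Circle.exp (2 * Real.pi * ((l₁ - c) / w₁)))).trans
      (k.trans ((Homeomorph.mulLeft (Circle.exp (2 * Real.pi * ((c - l₂) / w₂)))).trans c₂.symm)))
  refine ⟨h, isAttachingMap_of_equator ha ha₀ hb hb₀ e₁ e₂ hl₁ hl₂ hb₁ hb₂ h, r, hr, ?_⟩
  rintro z₁ z₂ ⟨q, hq, p, hpK₁, hpK₂, hpq, hz₁, hz₂⟩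
  obtain ⟨hs₁, hs₂⟩ := MorseCell.mem_endSlices_of_mem_carriers hne hpos hpK₁ hpK₂
  have hd := hr' p q hpK₁ hpK₂ hq hpq
  have hc₁ : c₁ z₁ = Circle.exp (2 * Real.pi * ((p 1 - l₁) / w₁)) := by
    refine hzero _ _ ((equatorHomeomorph_spec ha ha₀.le e₁ hl₁ z₁).symm.trans ?_)
    rw [← hz₁]
    exact hp₁ ⟨p, hpK₁⟩ hs₁
  have hc₂ : c₂ z₂ = Circle.exp (2 * Real.pi * ((p 1 - l₂) / w₂)) := by
    refine hzero _ _ ((equatorHomeomorph_spec hb hb₀.le e₂ hl₂ z₂).symm.trans ?_)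
    rw [← hz₂]
    exact hp₂ ⟨p, hpK₂⟩ hs₂
  change c₂.symm (Circle.exp (2 * Real.pi * ((c - l₂) / w₂)) *
    k (Circle.exp (2 * Real.pi * ((l₁ - c) / w₁)) * c₁ z₁)) = z₂
  rw [c₂.symm_apply_eq, hc₁, hc₂, ← Circle.exp_add, hk, ← Circle.exp_add]
  · congr 1
    field_simp
    ring
  · have h1 : 2 * Real.pi * ((l₁ - c) / w₁) + 2 * Real.pi * ((p 1 - l₁) / w₁) =
        (p 1 - c) * (2 * Real.pi / w₁) := by
      field_simp
      ring
    rw [h1, abs_mul, abs_of_pos (by positivity : 0 < 2 * Real.pi / w₁)]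
    calc |p 1 - c| * (2 * Real.pi / w₁)
        ≤ ε * w₁ / (2 * Real.pi) * (2 * Real.pi / w₁) := by gcongr
      _ = ε := by field_simp
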